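/- Let $1\le k\le n-1$, let $S^n\subset\mathbb R^{n+1}$ be the unit sphere with surface measure, and let $\Xi$ be the set of $k$-dimensional totally geodesic submanifolds $\xi=V\cap S^n$ of $S^n$, where $V$ runs over the $(k+1)$-dimensional linear subspaces of $\mathbb R^{n+1}$. Let $(Rf)(\xi)=\int_\xi f\,d_\xi x$ be the totally geodesic Radon transform ($d_\xi x$ is the $k$-dimensional surface measure on $\xi$). For a function $\varphi$ on $\Xi$, $x\in S^n$ and $r=\cos\theta$, $\theta\in[0,\pi/2]$, let $$(R^*_x\varphi)(r)=\int_{K}\varphi(r_x\,\rho\, g_\theta^{-1}\xi_0)\,d\rho ,$$ where $K=SO(n)$ is the stabilizer of $e_{n+1}$ in $SO(n+1)$ with its Haar probability measure, $r_x\in SO(n+1)$ is any rotation with $r_xe_{n+1}=x$, $\xi_0$ is the unit sphere of $\mathrm{span}(e_1,\dots,e_{k+1})$, and $g_\theta^{-1}$ is the rotation in the plane $(e_{k+1},e_{n+1})$ that sends $e_{k+1}$ to $\sin\theta\, e_{k+1}+\cos\theta\, e_{n+1}$; thus $(R^*_x\varphi)(r)$ is the average of $\varphi$ over the $\xi\in\Xi$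 at geodesic distance $\theta$ from $x$. Let $1\le p<\infty$, let $f\in L^p(S^n)$ be even, and put $\varphi=Rf$. Then the integrals below converge absolutely for almost all $x$ and all $s\in(0,1)$, and $$f(x)=\lim_{s\to1^-}\Big(\frac1{2s}\frac{\partial}{\partial s}\Big)^{k}\Big[\frac{\pi^{-k/2}}{\Gamma(k/2)}\int_0^s(s^2-r^2)^{k/2-1}(R^*_x\varphi)(r)\,r^k\,dr\Big];$$ if $k$ is even, then also $$f(x)=\lim_{s\to1^-}\frac1{2\pi^{k/2}}\Big(\frac1{2s}\frac{\partial}{\partial s}\Big)^{k/2}\big[s^{k-1}(R^*_x\varphi)(s)\big];$$ and, alternatively, for every $k$, $$f(x)=\lim_{s\to1^-}\Big(\frac{\partial}{\partial s}\Big)^{k}\Big[\frac{2^{-k}\pi^{-k/2}}{\Gamma(k/2)}\int_0^s(s^2-r^2)^{k/2-1}(R^*_x\varphi)(r)\,r\,dr\Big].$$ Here, for each $s\in(0,1)$, the expressions in square brackets, as functions of $x$, belong to $L^p(S^n)$; as $L^p(S^n)$-valued functions of $s\in(0,1)$ they are continuously differentiable up to the order of the differential operator, the derivatives are those of these $L^p$-valued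 functions, and the limits are in the $L^p$-norm. If $f$ is continuous and even, then for every $x$ the expressions in square brackets are continuously differentiable in $s\in(0,1)$ up to that order in the usual sense, and the limits hold uniformly in $x\in S^n$. -/

import Mathlib

open MeasureTheory Set Filter Topology
open scoped ENNReal

noncomputable section

namespace FunkRadon

/-- Euclidean space `ℝ^{n+1}`, with coordinates indexed by `0, …, n`. -/
abbrev E (n : ℕ) : Type := EuclideanSpace ℝ (Fin (n + 1))

/-- The unit sphere `S^n` in `ℝ^{n+1}`. -/
abbrev S (n : ℕ) : Type := Metric.sphere (0 : E n) 1

/-- The usual surface measure on `S^n`. -/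
def sigma (n : ℕ) : Measure (S n) := (volume : Measure (E n)).toSphere

/-- The rotation group `SO(n+1)`. -/
abbrev SO (n : ℕ) : Type := Matrix.specialOrthogonalGroup (Fin (n + 1)) ℝ

/-- The last coordinate unit vector of `ℝ^{n+1}`. -/
def pole (n : ℕ) : E n := EuclideanSpace.single (Fin.last n) 1

/-! ### The action of rotations -/

theorem SO.transpose_mul (n : ℕ) (g : SO n) : (g.1).transpose * g.1 = 1 :=
  (Matrix.mem_orthogonalGroup_iff' _ _).1 g.2.1

theorem SO.mul_transpose (n : ℕ) (g : SO n) : g.1 * (g.1).transpose = 1 :=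
  (Matrix.mem_orthogonalGroup_iff _ _).1 g.2.1

/-- A rotation as a linear isometry of `ℝ^{n+1}`. -/
def rot {n : ℕ} (g : SO n) : E n →ₗᵢ[ℝ] E n :=
  (Matrix.toEuclideanLin g.1).isometryOfInner (fun x y => by
    have h := SO.transpose_mul n g
    simp only [EuclideanSpace.inner_eq_star_dotProduct, Matrix.toLpLin_apply, star_trivial]
    rw [Matrix.dotProduct_mulVec, Matrix.vecMul_mulVec, h, Matrix.vecMul_one])

theorem rot_apply {n : ℕ} (g : SO n) (x : E n) :
    rot g x = WithLp.toLp 2 (g.1.mulVec x.ofLp) := rfl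

theorem rot_mul {n : ℕ} (g h : SO n) (x : E n) : rot (g * h) x = rot g (rot h x) := by
  simp [rot_apply]

theorem rot_one {n : ℕ} (x : E n) : rot (1 : SO n) x = x := by
  simp [rot_apply]

/-! ### `SO(n+1)` and its subgroup `K = SO(n)` as compact groups -/

instance (n : ℕ) : MeasurableSpace (SO n) := borel _

instance (n : ℕ) : BorelSpace (SO n) := ⟨rfl⟩

instance (n : ℕ) : IsTopologicalGroup (SO n) where
  continuous_mul := by fun_prop
  continuous_inv := by
    refine Continuous.subtype_mk (f := fun g : SO n => (g.1).transpose) ?_ _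
    exact continuous_subtype_val.matrix_transpose

instance (n : ℕ) : CompactSpace (SO n) := by
  refine isCompact_iff_compactSpace.1 ?_
  have hc : IsCompact (Set.univ.pi fun _ : Fin (n + 1) =>
      Set.univ.pi fun _ : Fin (n + 1) => Set.Icc (-1 : ℝ) 1) :=
    isCompact_univ_pi fun _ => isCompact_univ_pi fun _ => isCompact_Icc
  refine IsCompact.of_isClosed_subset hc ?_ ?_
  · have : ((Matrix.specialOrthogonalGroup (Fin (n + 1)) ℝ : Submonoid _) :
        Set (Matrix (Fin (n + 1)) (Fin (n + 1)) ℝ)) =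
        {A | A * A.transpose = 1} ∩ {A | A.det = 1} := by
      ext A
      exact and_congr (Matrix.mem_orthogonalGroup_iff _ _) Iff.rfl
    rw [this]
    exact (isClosed_eq (by fun_prop) continuous_const).inter
      (isClosed_eq (by fun_prop) continuous_const)
  · intro A hA i _ j _
    have h := (Matrix.mem_orthogonalGroup_iff _ _).1 hA.1
    have h1 : ∑ l, A i l * A i l = 1 := by
      have := congrFun (congrFun h i) i
      simpa [Matrix.mul_apply] using this
    have h2 : A i j * A i j ≤ 1 := by
      rw [← h1]
      exact Finset.single_le_sum (f := fun l => A i l * A i l)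
        (fun l _ => mul_self_nonneg _) (Finset.mem_univ j)
    constructor <;> nlinarith

/-- `K = SO(n)`, realized as the stabilizer of the last coordinate vector in `SO(n+1)`. -/
def K (n : ℕ) : Subgroup (SO n) where
  carrier := {g | rot g (pole n) = pole n}
  mul_mem' := by
    intro a b ha hb
    simp only [Set.mem_ofPred_eq] at *
    rw [rot_mul, hb, ha]
  one_mem' := rot_one _
  inv_mem' := by
    intro a ha
    simp only [Set.mem_ofPred_eq] at *
    rw [← ha, ← rot_mul, inv_mul_cancel, rot_one, ha]

instance (n : ℕ) : CompactSpace (K n) := by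
  refine isCompact_iff_compactSpace.1 (IsClosed.isCompact ?_)
  refine isClosed_eq (f := fun g : SO n => rot g (pole n)) ?_ continuous_const
  refine (PiLp.continuous_toLp 2 _).comp ?_
  exact Continuous.matrix_mulVec continuous_subtype_val continuous_const

/-- The Haar probability measure on `K`. -/
def haarK (n : ℕ) : Measure (K n) := Measure.haarMeasure ⊤

/-! ### Totally geodesic submanifolds and the Radon transform -/

/-- The `k`-dimensional totally geodesic submanifolds of `S^n`: each is `V ∩ S^n` for a unique
`(k+1)`-dimensional linear subspace `V` of `ℝ^{n+1}`, and is represented by this `V`. -/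
def Geod (n k : ℕ) : Type := {V : Submodule ℝ (E n) // Module.finrank ℝ V = k + 1}

/-- The inclusion of `V ∩ S^n`, viewed as the unit sphere of `V`, into `S^n`. -/
def incl {n : ℕ} (V : Submodule ℝ (E n)) (y : Metric.sphere (0 : V) 1) : S n :=
  ⟨((y : V) : E n), by
    exact mem_sphere_zero_iff_norm.2 (mem_sphere_zero_iff_norm.1 y.2)⟩

/-- The usual `k`-dimensional surface measure on `V ∩ S^n`. -/
def geodMeasure {n k : ℕ} (V : Geod n k) : Measure (Metric.sphere (0 : V.1) 1) :=
  (volume : Measure V.1).toSphere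

/-- The totally geodesic Radon transform: the integral of `f` over `V ∩ S^n` against the usual
`k`-dimensional surface measure. -/
def radon {𝕜 : Type*} [RCLike 𝕜] {n k : ℕ} (f : S n → 𝕜) (V : Geod n k) : 𝕜 :=
  ∫ y : Metric.sphere (0 : V.1) 1, f (incl V.1 y) ∂geodMeasure V

/-- The action of rotations on geodesic submanifolds. -/
def Geod.act {n k : ℕ} (g : SO n) (V : Geod n k) : Geod n k :=
  ⟨V.1.map (rot g).toLinearMap, by
    rw [← (Submodule.equivMapOfInjective (rot g).toLinearMap (rot g).injective V.1).finrank_eq]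
    exact V.2⟩

/-- The images of the first `k+1` coordinate vectors under the inverse of the rotation `g_θ`, which
has the matrix `[sin θ, cos θ; -cos θ, sin θ]` in the plane of the coordinate vectors number `k+1`
and `n+1`. The first `k` vectors are fixed, and vector number `k+1` goes to
`sin θ e_{k+1} + cos θ e_{n+1}`. -/
def frame {n k : ℕ} (hk : k < n) (θ : ℝ) (i : Fin (k + 1)) : E n :=
  if i = Fin.last k then
    Real.sin θ • EuclideanSpace.single (Fin.castLE (by omega) i) 1 + Real.cos θ • pole n
  else EuclideanSpace.single (Fin.castLE (by omega) i) 1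

theorem frame_orthonormal {n k : ℕ} (hk : k < n) (θ : ℝ) : Orthonormal ℝ (frame hk θ) := by
  have es : ∀ a b : Fin (n + 1), inner ℝ (EuclideanSpace.single a (1 : ℝ) : E n)
      (EuclideanSpace.single b (1 : ℝ)) = if a = b then 1 else 0 := by
    intro a b
    simp [EuclideanSpace.inner_single_left, PiLp.single_apply]
  have hne : ∀ i : Fin (k + 1), Fin.castLE (by omega : k + 1 ≤ n + 1) i ≠ Fin.last n := by
    intro i h
    have h1 := congrArg Fin.val h
    have h2 := i.2
    simp only [Fin.val_castLE, Fin.val_last] at h1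
    omega
  rw [orthonormal_iff_ite]
  intro i j
  unfold frame pole
  split_ifs with h1 h2 h3 h3 h3
  all_goals
    simp only [inner_add_left, inner_add_right, real_inner_smul_left, real_inner_smul_right, es,
      hne, (hne _).symm, Fin.castLE_inj, if_true, if_false]
  all_goals simp_all
  have := Real.sin_sq_add_cos_sq θ
  nlinarith

/-- The geodesic submanifold `g_θ⁻¹ ξ₀`, where `ξ₀` is the unit sphere of the span of the first
`k+1` coordinate vectors. It has geodesic distance `θ` from the pole, for `0 ≤ θ ≤ π/2`. -/
def Geod.base {n k : ℕ} (hk : k < n) (θ : ℝ) : Geod n k :=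
  ⟨Submodule.span ℝ (Set.range (frame hk θ)), by
    rw [finrank_span_eq_card (frame_orthonormal hk θ).linearIndependent, Fintype.card_fin]⟩

/-- The geodesic submanifold `g ρ g_θ⁻¹ ξ₀` with `r = cos θ`. For `ρ` in `K` it has geodesic distance
`θ` from the image of the pole under `g`. -/
def Geod.shifted {n k : ℕ} (hk : k < n) (r : ℝ) (g : SO n) (ρ : K n) : Geod n k :=
  Geod.act g (Geod.act ρ.1 (Geod.base hk (Real.arccos r)))

/-- The shifted dual Radon transform `(R*_x φ)(r)`, where `x` is the image of the pole under the
rotation `g`, and `r = cos θ`: the average of `φ` over the geodesic submanifolds at distance `θ`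
from `x`. -/
def shiftedDual {𝕜 : Type*} [RCLike 𝕜] {n k : ℕ} (hk : k < n) (φ : Geod n k → 𝕜) (g : SO n)
    (r : ℝ) : 𝕜 :=
  ∫ ρ : K n, φ (Geod.shifted hk r g ρ) ∂haarK n

/-! ### The expressions that are differentiated, and the modes of recovery -/

/-- `∫_0^s (s² - r²)^{k/2-1} h(r) r^m dr`. -/
def ekIntegral {𝕜 : Type*} [RCLike 𝕜] (k m : ℕ) (h : ℝ → 𝕜) (s : ℝ) : 𝕜 :=
  ∫ r in (0 : ℝ)..s, ((s ^ 2 - r ^ 2) ^ ((k : ℝ) / 2 - 1) * r ^ m) • h r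

/-- The integral `∫_0^s (s² - r²)^{k/2-1} h(r) r^m dr` converges absolutely. -/
def EKConverges {𝕜 : Type*} [RCLike 𝕜] (k m : ℕ) (h : ℝ → 𝕜) (s : ℝ) : Prop :=
  IntervalIntegrable (fun r => ((s ^ 2 - r ^ 2) ^ ((k : ℝ) / 2 - 1) * r ^ m) • h r) volume 0 s

/-- The operator `(1/2s) ∂/∂s`, on functions with values in a real normed space. -/
def eulerD {F : Type*} [NormedAddCommGroup F] [NormedSpace ℝ F] (h : ℝ → F) (s : ℝ) : F :=
  (1 / (2 * s)) • deriv h s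

/-- All integrals in `(R*_x R f)(r)` converge absolutely, for almost all `r ∈ (0,1)`, where
`x` is the image of the pole under the rotation `g`. -/
def DualRadonConverges {𝕜 : Type*} [RCLike 𝕜] {n k : ℕ} (hk : k < n) (f : S n → 𝕜) (g : SO n) :
    Prop :=
  ∀ᵐ r ∂(volume.restrict (Ioo (0 : ℝ) 1)),
    (∀ᵐ ρ ∂haarK n, Integrable
      (fun y => f (incl (Geod.shifted hk r g ρ).1 y)) (geodMeasure (Geod.shifted hk r g ρ))) ∧
    Integrable (fun ρ : K n => radon f (Geod.shifted hk r g ρ)) (haarK n)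

/-- `f = lim_{s → 1} T F(·, s)` in `L^p(S^n)`, where `T` is a differential operator of order `j` in
`s`. For every `s ∈ (0,1)` the function `F(·, s)` represents an element of `L^p`, which depends on
`s` in a `j` times continuously differentiable way, and `T` acts on this `L^p`-valued function. -/
def LpRecovers {𝕜 : Type*} [RCLike 𝕜] {n : ℕ} {p : ℝ≥0∞} [Fact (1 ≤ p)] {f : S n → 𝕜}
    (hf : MemLp f p (sigma n)) (j : ℕ)
    (T : (ℝ → Lp 𝕜 p (sigma n)) → ℝ → Lp 𝕜 p (sigma n)) (F : S n → ℝ → 𝕜) : Prop :=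
  ∃ Φ : ℝ → Lp 𝕜 p (sigma n),
    (∀ s ∈ Ioo (0 : ℝ) 1, Φ s =ᵐ[sigma n] fun x => F x s) ∧
    ContDiffOn ℝ j Φ (Ioo 0 1) ∧
    Tendsto (T Φ) (𝓝[<] 1) (𝓝 (hf.toLp f))

/-- `f = lim_{s → 1} T F(x, s)` uniformly in `x ∈ S^n`, where `T` is a differential operator of
order `j` in `s`, and `F(x, ·)` is `j` times continuously differentiable on `(0,1)` for every
`x`. -/
def UniformlyRecovers {𝕜 : Type*} [RCLike 𝕜] {n : ℕ} (f : S n → 𝕜) (j : ℕ)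
    (T : (ℝ → 𝕜) → ℝ → 𝕜) (F : S n → ℝ → 𝕜) : Prop :=
  (∀ x, ContDiffOn ℝ j (F x) (Ioo 0 1)) ∧
  TendstoUniformly (fun s x => T (F x) s) f (𝓝[<] 1)

end FunkRadon

end

/-!
The Radon transform is connected with the function through spherical means. Let `M_t f(x)` be the
mean of `f` over the parallel of height `t` around `x`, where the height is the cosine of the
geodesic distance from `x` (`parallelMean`). A geodesic submanifold at the distance `arccos r` from
`x` is an isometric copy of `S^k`, and its points have the heights `r u`, where `u` is the height on
`S^k`. The group `K` acts transitively on parallels, so that the mean over `K` replaces `f` by its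
spherical means, and the heights on `S^k` have the density `(1 - u²)^{k/2-1}`. For even `f` this
gives (`AdmissibleAt.shiftedDual_radon`)

  `(R*_x R f)(r) = 2 |S^{k-1}| r^{1-k} ∫_0^r (r² - t²)^{k/2-1} M_t f(x) dt`.

A fractional integral of this expression composes two Abel type kernels. With the weight `r^k` the
composition is a beta integral in the variable `r²` and equals a multiple of `(s² - t²)^{k-1}`
(`lintegral_kernel_sq`). With the weight `r` the substitution `w = r - st/r` leads to a multiple of
`(s - t)^{k-1}` (`lintegral_kernel_inv`). For even `k` the kernel `(r² - t²)^{k/2-1}` is itself a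
polynomial, and no fractional integral is needed. The differential operators undo these polynomial
kernels, and what remains is `s⁻¹ M_s f(x)` or `M_s f(x)` (`eulerD_iterate_powIntegral`,
`iteratedDeriv_powIntegral`), which tends to `f(x)` as `s → 1`.

For continuous `f` the spherical means are continuous in `t`, uniformly in `x`. On `L^p` they are
contractions, by the invariance of the surface measure (`eLpNorm_parallelMean_le`), and hence depend
continuously on `t` by the density of continuous functions (`continuous_meanLp`); the integrals of
these `L^p`-valued functions are represented by the pointwise integrals
(`coeFn_intervalIntegral_Lp`). The Radon transform of an element of `L^p` is not affected by the
choice of a representative in the following sense: for almost every `x`, almost no parallel around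
`x` meets a given null set in a set of positive measure, and then almost no geodesic submanifold at
a distance less than `π/2` from `x` does (`ae_shifted_of_ae_parallel`, `ae_admissibleAt`).
-/

noncomputable section

namespace FunkRadon

/-! ### Rotations of the sphere -/

instance (n : ℕ) : SecondCountableTopology (SO n) := by
  have : SecondCountableTopology (Matrix (Fin (n + 1)) (Fin (n + 1)) ℝ) :=
    inferInstanceAs (SecondCountableTopology (Fin (n + 1) → Fin (n + 1) → ℝ))
  exact TopologicalSpace.Subtype.secondCountableTopology _

instance (n : ℕ) : T2Space (SO n) := by
  have : T2Space (Matrix (Fin (n + 1)) (Fin (n + 1)) ℝ) :=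
    inferInstanceAs (T2Space (Fin (n + 1) → Fin (n + 1) → ℝ))
  exact instT2SpaceSubtype

instance (n : ℕ) : PolishSpace (SO n) := by
  have := TopologicalSpace.metrizableSpace_of_t3_secondCountable (SO n)
  let _ := TopologicalSpace.metrizableSpaceMetric (SO n)
  infer_instance

instance (n : ℕ) : IsFiniteMeasure (sigma n) := by unfold sigma; infer_instance

instance (n : ℕ) : (haarK n).IsHaarMeasure := by unfold haarK; infer_instance

instance (n : ℕ) : IsProbabilityMeasure (haarK n) :=
  ⟨by simpa [haarK] using Measure.haarMeasure_self (K₀ := (⊤ : TopologicalSpace.PositiveCompacts (K n)))⟩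

/-- The Haar probability measure on `SO(n+1)`. -/
def haarSO (n : ℕ) : Measure (SO n) := Measure.haarMeasure ⊤

instance (n : ℕ) : (haarSO n).IsHaarMeasure := by unfold haarSO; infer_instance

instance (n : ℕ) : IsProbabilityMeasure (haarSO n) :=
  ⟨by simpa [haarSO] using Measure.haarMeasure_self (K₀ := (⊤ : TopologicalSpace.PositiveCompacts (SO n)))⟩

/-- A compact group is unimodular: left Haar probability measures are right invariant. -/
theorem isMulRightInvariant_of_isProbabilityMeasure {G : Type*} [TopologicalSpace G] [Group G]
    [IsTopologicalGroup G] [CompactSpace G] [MeasurableSpace G] [BorelSpace G] (μ : Measure G)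
    [μ.IsHaarMeasure] [IsProbabilityMeasure μ] : μ.IsMulRightInvariant := by
  refine ⟨fun g => ?_⟩
  have : IsProbabilityMeasure (μ.map (· * g)) :=
    Measure.isProbabilityMeasure_map (by fun_prop)
  exact Measure.isHaarMeasure_eq_of_isProbabilityMeasure _ _

instance (n : ℕ) : (haarK n).IsMulRightInvariant := isMulRightInvariant_of_isProbabilityMeasure _

instance (n : ℕ) : (haarSO n).IsMulRightInvariant := isMulRightInvariant_of_isProbabilityMeasure _

/-- The action of a rotation on the unit sphere. -/
def rotS {n : ℕ} (g : SO n) (y : S n) : S n :=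
  ⟨rot g y.1, by simp⟩

theorem coe_rotS {n : ℕ} (g : SO n) (y : S n) : (rotS g y : E n) = rot g y := rfl

theorem rotS_mul {n : ℕ} (g h : SO n) (y : S n) : rotS (g * h) y = rotS g (rotS h y) :=
  Subtype.ext (rot_mul g h y)

theorem rotS_one {n : ℕ} (y : S n) : rotS (1 : SO n) y = y := Subtype.ext (rot_one y.1)

theorem rotS_neg {n : ℕ} (g : SO n) (y : S n) : rotS g (-y) = -rotS g y :=
  Subtype.ext (map_neg (rot g) y.1)

theorem isometry_rotS {n : ℕ} (g : SO n) : Isometry (rotS g : S n → S n) :=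
  Isometry.of_dist_eq fun x y => (rot g).isometry.dist_eq x.1 y.1

theorem continuous_rot {n : ℕ} : Continuous fun p : SO n × E n => rot p.1 p.2 := by
  refine (PiLp.continuous_toLp 2 _).comp ?_
  exact Continuous.matrix_mulVec (continuous_subtype_val.comp continuous_fst)
    ((PiLp.continuous_ofLp 2 _).comp continuous_snd)

theorem continuous_rotS {n : ℕ} : Continuous fun p : SO n × S n => rotS p.1 p.2 :=
  (continuous_rot.comp (continuous_fst.prodMk (continuous_subtype_val.comp continuous_snd))).subtype_mk _

/-- The north pole, as a point of the unit sphere. -/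
def poleS (n : ℕ) : S n := ⟨pole n, by simp [pole]⟩

theorem rotS_poleS {n : ℕ} {g : SO n} {x : S n} (h : rot g (pole n) = x) : rotS g (poleS n) = x :=
  Subtype.ext h

/-- The last coordinate of a point of the sphere, which is the cosine of its geodesic distance
from the pole. -/
def height {n : ℕ} (y : S n) : ℝ := y.1 (Fin.last n)

/-- A linear isometry of determinant one is given by a rotation matrix. -/
theorem exists_rot_eq {n : ℕ} (L : E n ≃ₗᵢ[ℝ] E n)
    (hL : LinearMap.det (L.toLinearEquiv : E n →ₗ[ℝ] E n) = 1) :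
    ∃ g : SO n, ∀ x, rot g x = L x := by
  classical
  let b := (EuclideanSpace.basisFun (Fin (n + 1)) ℝ)
  let A := LinearMap.toMatrix b.toBasis b.toBasis (L.toLinearEquiv : E n →ₗ[ℝ] E n)
  have hA : ∀ x : E n, WithLp.toLp 2 (A.mulVec x.ofLp) = L x := by
    intro x
    have h := LinearMap.toMatrix_mulVec_repr b.toBasis b.toBasis
      (L.toLinearEquiv : E n →ₗ[ℝ] E n) x
    have h1 : (b.toBasis.repr x : Fin (n + 1) → ℝ) = x.ofLp := by ext; simp [b]
    rw [h1] at h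
    rw [show A.mulVec x.ofLp = _ from h]
    ext i
    simp [b]
  have hdet : A.det = 1 := by
    rw [LinearMap.det_toMatrix]
    exact hL
  have horth : A.transpose * A = 1 := by
    have key : ∀ i j, inner ℝ (L (b i)) (L (b j)) = if i = j then (1 : ℝ) else 0 := by
      intro i j
      rw [L.inner_map_map]
      exact (orthonormal_iff_ite.1 b.orthonormal) i j
    ext i j
    have := key j i
    rw [← hA, ← hA] at this
    simp only [EuclideanSpace.inner_eq_star_dotProduct, star_trivial] at this
    simp only [b, EuclideanSpace.basisFun_apply, PiLp.ofLp_single, Matrix.mulVec_single_one] at this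
    rw [Matrix.mul_apply, Matrix.one_apply]
    simp only [dotProduct, Matrix.col_apply] at this
    simp only [Matrix.transpose_apply, this, eq_comm]
  refine ⟨⟨A, (Matrix.mem_orthogonalGroup_iff' _ _).2 horth, hdet⟩, fun x => ?_⟩
  rw [rot_apply]
  exact hA x

theorem det_reflection_singleton {n : ℕ} {v : E n} (hv : v ≠ 0) :
    LinearMap.det ((ℝ ∙ v)ᗮ.reflection.toLinearEquiv : E n →ₗ[ℝ] E n) = -1 := by
  rw [Submodule.det_reflection, Submodule.orthogonal_orthogonal, finrank_span_singleton hv, pow_one]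

/-- For `n ≥ 2` the group `K = SO(n)` acts transitively on the parallels of the sphere: if `y ≠ y'`
have the same height, the reflection that exchanges them fixes the pole, and is corrected to a
rotation by a reflection that fixes both the pole and `y'`. -/
theorem exists_mem_K_rotS_eq {n : ℕ} (hn : 2 ≤ n) {y y' : S n} (h : height y = height y') :
    ∃ ρ : K n, rotS ρ.1 y = y' := by
  by_cases hyy : y = y'
  · exact ⟨1, by simp [hyy, rotS_one]⟩
  have hyy' : y.1 - y'.1 ≠ 0 := sub_ne_zero.2 fun h => hyy (Subtype.ext h)
  obtain ⟨v, hv, hv0⟩ : ∃ v ∈ (Submodule.span ℝ {pole n, y'.1})ᗮ, v ≠ 0 := by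
    refine (Submodule.ne_bot_iff _).1 fun hbot => ?_
    have h1 := Submodule.finrank_add_finrank_orthogonal (Submodule.span ℝ {pole n, y'.1})
    rw [hbot, finrank_bot, finrank_euclideanSpace_fin] at h1
    have h2 : Module.finrank ℝ (Submodule.span ℝ (({pole n, y'.1} : Finset (E n)) : Set (E n))) ≤ 2 :=
      (finrank_span_finset_le_card _).trans Finset.card_le_two
    rw [Finset.coe_pair] at h2
    omega
  have hvp : inner ℝ v (pole n) = 0 :=
    (Submodule.mem_orthogonal' _ _).1 hv _ (Submodule.subset_span (by simp))
  have hvy : inner ℝ v y'.1 = 0 :=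
    (Submodule.mem_orthogonal' _ _).1 hv _ (Submodule.subset_span (by simp))
  have fix : ∀ {u w : E n}, inner ℝ u w = 0 → (ℝ ∙ u)ᗮ.reflection w = w := fun {u w} h0 =>
    Submodule.reflection_mem_subspace_eq_self (Submodule.mem_orthogonal_singleton_iff_inner_right.2 h0)
  have hp : inner ℝ (y.1 - y'.1) (pole n) = 0 := by
    have h' : y.1 (Fin.last n) = y'.1 (Fin.last n) := h
    simp [pole, EuclideanSpace.inner_single_right, h']
  have hnorm : ‖y.1‖ = ‖y'.1‖ := by simp
  obtain ⟨g, hg⟩ := exists_rot_eq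
    ((ℝ ∙ (y.1 - y'.1))ᗮ.reflection.trans (ℝ ∙ v)ᗮ.reflection) (by
      have := LinearMap.det_comp ((ℝ ∙ v)ᗮ.reflection.toLinearEquiv : E n →ₗ[ℝ] E n)
        ((ℝ ∙ (y.1 - y'.1))ᗮ.reflection.toLinearEquiv : E n →ₗ[ℝ] E n)
      rw [det_reflection_singleton hv0, det_reflection_singleton hyy'] at this
      exact (show _ = _ from this).trans (by norm_num))
  refine ⟨⟨g, ?_⟩, ?_⟩
  · change rot g (pole n) = pole n
    rw [hg, LinearIsometryEquiv.trans_apply, fix hp, fix hvp]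
  · apply Subtype.ext
    rw [coe_rotS, hg, LinearIsometryEquiv.trans_apply, Submodule.reflection_sub hnorm, fix hvy]

theorem _root_.Continuous.rotS {n : ℕ} {X : Type*} [TopologicalSpace X] {g : X → SO n} {y : X → S n}
    (hg : Continuous g) (hy : Continuous y) : Continuous fun x => FunkRadon.rotS (g x) (y x) := by
  have h := hg.prodMk hy
  have h2 := (continuous_rotS (n := n)).comp h
  exact h2

theorem _root_.Measurable.rotS {n : ℕ} {X : Type*} [MeasurableSpace X] {g : X → SO n} {y : X → S n}
    (hg : Measurable g) (hy : Measurable y) : Measurable fun x => FunkRadon.rotS (g x) (y x) := by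
  have h := hg.prodMk hy
  have h2 := (continuous_rotS (n := n)).measurable.comp h
  exact h2

/-! ### Invariance of the surface measure -/

/-- The map between unit spheres induced by a linear isometry. -/
def sphereMap {V W : Type*} [NormedAddCommGroup V] [NormedSpace ℝ V] [NormedAddCommGroup W]
    [NormedSpace ℝ W] (L : V ≃ₗᵢ[ℝ] W) (y : Metric.sphere (0 : V) 1) : Metric.sphere (0 : W) 1 :=
  ⟨L y, by simp⟩

open scoped Pointwise in
/-- Linear isometries preserve surface measures, since they preserve volumes of cones. -/
theorem measurePreserving_sphereMap {V W : Type*}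
    [NormedAddCommGroup V] [InnerProductSpace ℝ V] [FiniteDimensional ℝ V] [MeasurableSpace V]
    [BorelSpace V] [NormedAddCommGroup W] [InnerProductSpace ℝ W] [FiniteDimensional ℝ W]
    [MeasurableSpace W] [BorelSpace W] (L : V ≃ₗᵢ[ℝ] W) :
    MeasurePreserving (sphereMap L) (volume : Measure V).toSphere (volume : Measure W).toSphere := by
  have hm : Measurable (sphereMap L) :=
    ((L.continuous.comp continuous_subtype_val).subtype_mk _).measurable
  refine ⟨hm, Measure.ext fun s hs => ?_⟩
  rw [Measure.map_apply hm hs, Measure.toSphere_apply' _ (hm hs), Measure.toSphere_apply' _ hs,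
    L.toLinearEquiv.finrank_eq]
  congr 1
  have h1 : Ioo (0 : ℝ) 1 • ((↑) '' (sphereMap L ⁻¹' s) : Set V)
      = L ⁻¹' (Ioo (0 : ℝ) 1 • ((↑) '' s : Set W)) := by
    ext v
    simp only [Set.mem_smul, mem_image, mem_preimage, Subtype.exists, exists_and_right,
      exists_eq_right]
    constructor
    · rintro ⟨a, ha, w, ⟨hw, hws⟩, rfl⟩
      exact ⟨a, ha, L w, ⟨by simpa using hw, hws⟩, by simp⟩
    · rintro ⟨a, ha, w, ⟨hw, hws⟩, hv⟩
      refine ⟨a, ha, L.symm w, ⟨by simpa using hw, ?_⟩, ?_⟩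
      · simpa [sphereMap] using hws
      · apply L.injective
        simp [hv]
  rw [h1]
  exact L.measurePreserving.measure_preimage_equiv (f := L.toHomeomorph.toMeasurableEquiv) _

theorem measurePreserving_rotS {n : ℕ} (g : SO n) :
    MeasurePreserving (rotS g) (sigma n) (sigma n) :=
  measurePreserving_sphereMap ((rot g).toLinearIsometryEquiv rfl)

theorem measurePreserving_neg_sigma (n : ℕ) :
    MeasurePreserving (fun x : S n => -x) (sigma n) (sigma n) :=
  measurePreserving_sphereMap (LinearIsometryEquiv.neg ℝ)

/-! ### Averages over the stabilizer of the pole -/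

/-- The point of height `t` on the meridian through the coordinate vector number `k + 1`; `t` is
truncated to `[-1, 1]`. -/
def meridian {n k : ℕ} (hk : k < n) (t : ℝ) : S n :=
  ⟨frame hk (Real.arccos t) (Fin.last k), by simpa using (frame_orthonormal hk _).1 (Fin.last k)⟩

theorem height_meridian {n k : ℕ} (hk : k < n) {t : ℝ} (ht : t ∈ Icc (-1 : ℝ) 1) :
    height (meridian hk t) = t := by
  have : ¬ (k : ℕ) = n := hk.ne
  simp [height, meridian, frame, pole, Real.cos_arccos ht.1 ht.2, Fin.ext_iff,
    this.imp Eq.symm]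

theorem meridian_one {n k : ℕ} (hk : k < n) : meridian hk 1 = poleS n :=
  Subtype.ext (by simp [meridian, frame, poleS])

theorem continuous_meridian {n k : ℕ} (hk : k < n) : Continuous (meridian hk) := by
  refine Continuous.subtype_mk ?_ _
  simp only [frame, if_true]
  have := Real.continuous_arccos
  fun_prop

theorem height_mem {n : ℕ} (y : S n) : height y ∈ Icc (-1 : ℝ) 1 := by
  have h := PiLp.norm_apply_le y.1 (Fin.last n)
  rw [norm_eq_of_mem_sphere y, Real.norm_eq_abs] at h
  exact abs_le.1 h

theorem height_neg {n : ℕ} (y : S n) : height (-y) = -height y := rfl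

/-- By transitivity and right invariance, the mean over the `K`-orbit of a point depends on the
height of the point only. -/
theorem lintegral_haarK_congr {n : ℕ} (hn : 2 ≤ n) (F : S n → ℝ≥0∞) (g : SO n) {y y' : S n}
    (h : height y = height y') :
    ∫⁻ ρ : K n, F (rotS g (rotS ρ.1 y)) ∂haarK n = ∫⁻ ρ : K n, F (rotS g (rotS ρ.1 y')) ∂haarK n := by
  obtain ⟨κ, rfl⟩ := exists_mem_K_rotS_eq hn h
  rw [← lintegral_mul_right_eq_self _ κ]
  simp only [Subgroup.coe_mul, rotS_mul]

theorem integral_haarK_congr {F : Type*} [NormedAddCommGroup F] [NormedSpace ℝ F] {n : ℕ}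
    (hn : 2 ≤ n) (f : S n → F) (g : SO n) {y y' : S n} (h : height y = height y') :
    ∫ ρ : K n, f (rotS g (rotS ρ.1 y)) ∂haarK n = ∫ ρ : K n, f (rotS g (rotS ρ.1 y')) ∂haarK n := by
  obtain ⟨κ, rfl⟩ := exists_mem_K_rotS_eq hn h
  rw [← integral_mul_right_eq_self _ κ]
  simp only [Subgroup.coe_mul, rotS_mul]

/-- Two rotations with the same image of the pole differ by an element of `K`. -/
theorem exists_mem_K_eq_mul {n : ℕ} {g g' : SO n} (h : rotS g (poleS n) = rotS g' (poleS n)) :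
    ∃ κ : K n, g' = g * κ.1 := by
  refine ⟨⟨g⁻¹ * g', ?_⟩, by simp⟩
  change rot (g⁻¹ * g') (pole n) = pole n
  have h' : rot g (pole n) = rot g' (pole n) := congrArg Subtype.val h
  rw [rot_mul, ← h', ← rot_mul, inv_mul_cancel, rot_one]

theorem lintegral_haarK_congr_pole {n : ℕ} (F : S n → ℝ≥0∞) {g g' : SO n} (y : S n)
    (h : rotS g (poleS n) = rotS g' (poleS n)) :
    ∫⁻ ρ : K n, F (rotS g (rotS ρ.1 y)) ∂haarK n = ∫⁻ ρ : K n, F (rotS g' (rotS ρ.1 y)) ∂haarK n := by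
  obtain ⟨κ, rfl⟩ := exists_mem_K_eq_mul h
  rw [← lintegral_mul_left_eq_self _ κ]
  simp only [Subgroup.coe_mul, rotS_mul]

theorem integral_haarK_congr_pole {F : Type*} [NormedAddCommGroup F] [NormedSpace ℝ F] {n : ℕ}
    (f : S n → F) {g g' : SO n} (y : S n) (h : rotS g (poleS n) = rotS g' (poleS n)) :
    ∫ ρ : K n, f (rotS g (rotS ρ.1 y)) ∂haarK n = ∫ ρ : K n, f (rotS g' (rotS ρ.1 y)) ∂haarK n := by
  obtain ⟨κ, rfl⟩ := exists_mem_K_eq_mul h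
  rw [← integral_mul_left_eq_self _ κ]
  simp only [Subgroup.coe_mul, rotS_mul]

theorem measurable_rotS_rotS {n : ℕ} {X : Type*} [MeasurableSpace X] {g : X → SO n} {ρ : X → K n}
    {y : X → S n} (hg : Measurable g) (hρ : Measurable ρ) (hy : Measurable y) :
    Measurable fun x => rotS (g x) (rotS (ρ x).1 (y x)) := by
  have h1 : Measurable fun x => (ρ x).1 := measurable_subtype_coe.comp hρ
  have h2 := h1.rotS hy
  exact hg.rotS h2

/-- The surface measure is, up to its mass, the image of the Haar measure of `SO(n+1)` under the
orbit map of the pole: average `F(g x)` over all `g` and `x`, and use the invariance of each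
measure. -/
theorem lintegral_sigma_eq {n : ℕ} {τ : S n → SO n} (hτ : ∀ x, rotS (τ x) (poleS n) = x)
    {F : S n → ℝ≥0∞} (hF : Measurable F) :
    ∫⁻ x, F x ∂sigma n = sigma n univ * ∫⁻ g, F (rotS g (poleS n)) ∂haarSO n := by
  have h1 : ∫⁻ g, ∫⁻ x, F (rotS g x) ∂sigma n ∂haarSO n = ∫⁻ x, F x ∂sigma n := by
    simp_rw [(measurePreserving_rotS _).lintegral_comp hF]
    simp
  have hm : Measurable (Function.uncurry fun (g : SO n) (x : S n) => F (rotS g x)) :=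
    hF.comp continuous_rotS.measurable
  rw [← h1, lintegral_lintegral_swap hm.aemeasurable]
  have h2 : ∀ x : S n, ∫⁻ g, F (rotS g x) ∂haarSO n = ∫⁻ g, F (rotS g (poleS n)) ∂haarSO n := by
    intro x
    rw [← lintegral_mul_right_eq_self (μ := haarSO n) (fun g => F (rotS g (poleS n))) (τ x)]
    simp only [rotS_mul, hτ]
  simp_rw [h2]
  rw [lintegral_const, mul_comm]

/-- A function of the sphere and a parameter is measurable once its pullback along the orbit map of
the pole is, because measurable surjections between Polish spaces are quotient maps of measurable
spaces. The section `τ` of the orbit map need not be measurable. -/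
theorem measurable_of_comp_rotS {n : ℕ} {τ : S n → SO n} (hτ : ∀ x, rotS (τ x) (poleS n) = x)
    {β : Type*} [MeasurableSpace β] {G : S n × ℝ → β}
    (h : Measurable fun p : SO n × ℝ => G (rotS p.1 (poleS n), p.2)) : Measurable G := by
  have hm : Measurable fun p : SO n × ℝ => (rotS p.1 (poleS n), p.2) :=
    (measurable_fst.rotS measurable_const).prodMk measurable_snd
  exact (hm.measurable_comp_iff_of_surjective
    (fun q => ⟨(τ q.1, q.2), Prod.ext (hτ _) rfl⟩)).1 h

theorem measurable_lintegral_haarK {n : ℕ} {τ : S n → SO n} (hτ : ∀ x, rotS (τ x) (poleS n) = x)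
    {F : S n → ℝ≥0∞} (hF : Measurable F) {y : ℝ → S n} (hy : Measurable y) :
    Measurable fun p : S n × ℝ => ∫⁻ ρ : K n, F (rotS (τ p.1) (rotS ρ.1 (y p.2))) ∂haarK n := by
  refine measurable_of_comp_rotS hτ ?_
  simp_rw [lintegral_haarK_congr_pole F _ (hτ _)]
  refine Measurable.lintegral_prod_right' (f := fun q : (SO n × ℝ) × K n =>
    F (rotS q.1.1 (rotS q.2.1 (y q.1.2)))) ?_
  have h := measurable_rotS_rotS (X := (SO n × ℝ) × K n) (measurable_fst.comp measurable_fst)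
    measurable_snd (hy.comp (measurable_snd.comp measurable_fst))
  exact hF.comp h

/-- Averaging over parallels preserves the integral over the sphere. -/
theorem lintegral_sigma_lintegral_haarK {n : ℕ} {τ : S n → SO n}
    (hτ : ∀ x, rotS (τ x) (poleS n) = x) {F : S n → ℝ≥0∞} (hF : Measurable F) (y : S n) :
    ∫⁻ x, ∫⁻ ρ : K n, F (rotS (τ x) (rotS ρ.1 y)) ∂haarK n ∂sigma n = ∫⁻ x, F x ∂sigma n := by
  have hm : Measurable fun x : S n => ∫⁻ ρ : K n, F (rotS (τ x) (rotS ρ.1 y)) ∂haarK n := by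
    have h := measurable_lintegral_haarK hτ hF (y := fun _ => y) measurable_const
    have h' : Measurable fun x : S n => (x, (0 : ℝ)) := by fun_prop
    have h2 := h.comp h'
    exact h2
  rw [lintegral_sigma_eq hτ hm, lintegral_sigma_eq hτ hF]
  simp_rw [lintegral_haarK_congr_pole F y (hτ _)]
  have hm' : Measurable (Function.uncurry fun (g : SO n) (ρ : K n) => F (rotS g (rotS ρ.1 y))) := by
    have h := measurable_rotS_rotS (X := SO n × K n) measurable_fst measurable_snd
      (measurable_const (a := y))
    have h' := hF.comp h
    exact h'
  rw [lintegral_lintegral_swap hm'.aemeasurable]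
  have h2 : ∀ ρ : K n, ∫⁻ g, F (rotS g (rotS ρ.1 y)) ∂haarSO n
      = ∫⁻ g, F (rotS g (poleS n)) ∂haarSO n := by
    intro ρ
    rw [← lintegral_mul_right_eq_self (μ := haarSO n) (fun g => F (rotS g (poleS n))) (ρ.1 * τ y)]
    simp only [rotS_mul, hτ]
  simp_rw [h2]
  simp

theorem measurable_integral_haarK {𝕜 : Type*} [RCLike 𝕜] {n : ℕ} {τ : S n → SO n}
    (hτ : ∀ x, rotS (τ x) (poleS n) = x)
    {f : S n → 𝕜} (hf : Measurable f) {y : ℝ → S n} (hy : Measurable y) :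
    Measurable fun p : S n × ℝ => ∫ ρ : K n, f (rotS (τ p.1) (rotS ρ.1 (y p.2))) ∂haarK n := by
  refine measurable_of_comp_rotS hτ ?_
  simp_rw [integral_haarK_congr_pole f _ (hτ _)]
  refine (StronglyMeasurable.integral_prod_right' (f := fun q : (SO n × ℝ) × K n =>
    f (rotS q.1.1 (rotS q.2.1 (y q.1.2)))) (Measurable.stronglyMeasurable ?_)).measurable
  have h := measurable_rotS_rotS (X := (SO n × ℝ) × K n) (measurable_fst.comp measurable_fst)
    measurable_snd (hy.comp (measurable_snd.comp measurable_fst))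
  exact hf.comp h

/-! ### The distribution of the height on a sphere -/

/-- Integration in polar coordinates. -/
theorem lintegral_eq_lintegral_toSphere {V : Type*} [NormedAddCommGroup V] [NormedSpace ℝ V]
    [FiniteDimensional ℝ V] [Nontrivial V] [MeasurableSpace V] [BorelSpace V] (μ : Measure V)
    [μ.IsAddHaarMeasure] {Φ : V → ℝ≥0∞} (hΦ : Measurable Φ) :
    ∫⁻ v, Φ v ∂μ = ∫⁻ y : Metric.sphere (0 : V) 1, (∫⁻ r in Ioi (0 : ℝ),
      ENNReal.ofReal (r ^ (Module.finrank ℝ V - 1)) * Φ (r • y.1)) ∂μ.toSphere := by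
  have hmp := μ.measurePreserving_homeomorphUnitSphereProd
  have h1 : ∫⁻ v, Φ v ∂μ = ∫⁻ v : ({0}ᶜ : Set V), Φ v ∂(μ.comap (↑)) := by
    rw [lintegral_subtype_comap (measurableSet_singleton _).compl, restrict_compl_singleton]
  rw [h1]
  have hm : Measurable fun p : Metric.sphere (0 : V) 1 × Ioi (0 : ℝ) => Φ (p.2.1 • p.1.1) :=
    hΦ.comp (by fun_prop)
  have h2 : ∫⁻ v : ({0}ᶜ : Set V), Φ v ∂(μ.comap (↑)) = ∫⁻ p, Φ (p.2.1 • p.1.1)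
      ∂(μ.toSphere.prod (Measure.volumeIoiPow (Module.finrank ℝ V - 1))) := by
    rw [← hmp.lintegral_comp hm]
    refine lintegral_congr fun v => ?_
    congr 1
    have hv : ‖(v : V)‖ ≠ 0 := norm_ne_zero_iff.2 v.2
    simp [smul_smul, hv]
  rw [h2, lintegral_prod _ hm.aemeasurable]
  refine lintegral_congr fun y => ?_
  have hm' : Measurable fun r : Ioi (0 : ℝ) => Φ (r.1 • y.1) := hΦ.comp (by fun_prop)
  rw [Measure.volumeIoiPow, lintegral_withDensity_eq_lintegral_mul _ (by fun_prop) hm',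
    ← lintegral_subtype_comap measurableSet_Ioi]
  rfl

theorem lintegral_norm_eq {V : Type*} [NormedAddCommGroup V] [NormedSpace ℝ V]
    [FiniteDimensional ℝ V] [Nontrivial V] [MeasurableSpace V] [BorelSpace V] (μ : Measure V)
    [μ.IsAddHaarMeasure] {h : ℝ → ℝ≥0∞} (hh : Measurable h) :
    ∫⁻ v, h ‖v‖ ∂μ = μ.toSphere univ * ∫⁻ r in Ioi (0 : ℝ),
      ENNReal.ofReal (r ^ (Module.finrank ℝ V - 1)) * h r := by
  rw [lintegral_eq_lintegral_toSphere μ (Φ := fun v => h ‖v‖) (hh.comp measurable_norm)]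
  have : ∀ y : Metric.sphere (0 : V) 1, ∫⁻ r in Ioi (0 : ℝ),
      ENNReal.ofReal (r ^ (Module.finrank ℝ V - 1)) * h ‖r • y.1‖ = ∫⁻ r in Ioi (0 : ℝ),
      ENNReal.ofReal (r ^ (Module.finrank ℝ V - 1)) * h r := by
    intro y
    refine setLIntegral_congr_fun measurableSet_Ioi fun r hr => ?_
    simp [norm_smul, abs_of_pos hr.out]
  simp_rw [this]
  rw [lintegral_const, mul_comm]

/-- The surface measure of `S^{k-1}`. -/
def area (k : ℕ) : ℝ := 2 * Real.pi ^ ((k : ℝ) / 2) / Real.Gamma ((k : ℝ) / 2)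

theorem area_pos {k : ℕ} (hk : 1 ≤ k) : 0 < area k := by
  have : (0 : ℝ) < k := by exact_mod_cast hk
  have := Real.Gamma_pos_of_pos (half_pos this)
  unfold area
  positivity

theorem toSphere_univ_euclidean {k : ℕ} (hk : 1 ≤ k) :
    (volume : Measure (EuclideanSpace ℝ (Fin k))).toSphere univ
      = ENNReal.ofReal (area k) := by
  have : Nonempty (Fin k) := ⟨⟨0, hk⟩⟩
  have hk0 : (0 : ℝ) < k := by exact_mod_cast hk
  rw [Measure.toSphere_apply_univ, EuclideanSpace.volume_ball, finrank_euclideanSpace_fin,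
    ENNReal.ofReal_one, one_pow, one_mul, ← ENNReal.ofReal_natCast, ← ENNReal.ofReal_mul hk0.le]
  congr 1
  rw [area, Fintype.card_fin, Real.Gamma_add_one (by positivity), Real.sqrt_eq_rpow, ← Real.rpow_natCast,
    ← Real.rpow_mul Real.pi_pos.le]
  have := Real.Gamma_pos_of_pos (half_pos hk0)
  rw [show (1 : ℝ) / 2 * k = k / 2 by ring]
  field_simp

/-- Tonelli's theorem on `ℝ^{k+1}`, with the last coordinate separated from the others. -/
theorem lintegral_euclidean_succ {k : ℕ} {Ψ : ℝ → ℝ → ℝ≥0∞}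
    (hΨ : Measurable (Function.uncurry Ψ)) :
    ∫⁻ x : E k, Ψ (x (Fin.last k)) ‖x‖
      = ∫⁻ z : ℝ, ∫⁻ y : EuclideanSpace ℝ (Fin k), Ψ z √(‖y‖ ^ 2 + z ^ 2) := by
  have e1 := (EuclideanSpace.volume_preserving_symm_measurableEquiv_toLp (Fin (k + 1))).symm
  have e2 := (volume_preserving_piFinSuccAbove (fun _ : Fin (k + 1) => ℝ) (Fin.last k)).symm
  have e3 := EuclideanSpace.volume_preserving_symm_measurableEquiv_toLp (Fin k)
  have hm1 : Measurable fun x : E k => Ψ (x (Fin.last k)) ‖x‖ :=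
    hΨ.comp (Measurable.prodMk (by fun_prop) (by fun_prop))
  have hm1' : Measurable fun y : Fin (k + 1) → ℝ => Ψ (y (Fin.last k)) ‖(WithLp.toLp 2 y : E k)‖ :=
    hm1.comp (MeasurableEquiv.toLp 2 (Fin (k + 1) → ℝ)).measurable
  have h1 : ∫⁻ x : E k, Ψ (x (Fin.last k)) ‖x‖
      = ∫⁻ y : Fin (k + 1) → ℝ, Ψ (y (Fin.last k)) ‖(WithLp.toLp 2 y : E k)‖ :=
    (e1.lintegral_comp hm1).symm
  have h2 : ∫⁻ y : Fin (k + 1) → ℝ, Ψ (y (Fin.last k)) ‖(WithLp.toLp 2 y : E k)‖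
      = ∫⁻ p : ℝ × (Fin k → ℝ), Ψ ((Fin.last k).insertNth (α := fun _ => ℝ) p.1 p.2 (Fin.last k))
        ‖(WithLp.toLp 2 ((Fin.last k).insertNth (α := fun _ => ℝ) p.1 p.2) : E k)‖ :=
    (e2.lintegral_comp hm1').symm
  rw [h1, h2, Measure.volume_eq_prod, lintegral_prod _ (by
    exact (hm1'.comp (MeasurableEquiv.measurable (MeasurableEquiv.piFinSuccAbove
      (fun _ : Fin (k + 1) => ℝ) (Fin.last k)).symm)).aemeasurable)]
  refine lintegral_congr fun z => ?_
  have hm3 : Measurable fun y : Fin k → ℝ => Ψ z √(‖WithLp.toLp 2 y‖ ^ 2 + z ^ 2) := by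
    refine hΨ.comp (Measurable.prodMk (by fun_prop) ?_)
    have : Measurable fun y : Fin k → ℝ => ‖(WithLp.toLp 2 y : EuclideanSpace ℝ (Fin k))‖ :=
      (MeasurableEquiv.toLp 2 (Fin k → ℝ)).measurable.norm
    fun_prop
  have h4 := e3.lintegral_comp hm3
  refine Eq.trans ?_ h4.symm
  refine lintegral_congr fun y => ?_
  have hl : (Fin.last k).insertNth (α := fun _ => ℝ) z y (Fin.last k) = z := by simp
  have hnn : ‖(WithLp.toLp 2 ((Fin.last k).insertNth z y) : E k)‖
      = √(‖(WithLp.toLp 2 y : EuclideanSpace ℝ (Fin k))‖ ^ 2 + z ^ 2) := by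
    rw [EuclideanSpace.norm_eq, EuclideanSpace.norm_sq_eq, Fin.sum_univ_castSucc]
    simp
  simp only [hl, hnn]

/-- The substitution `z = ρ u / √(1 - u²)`, which turns the quotient `z / √(ρ² + z²)` into `u`. -/
theorem lintegral_height_subst {ρ : ℝ} (hρ : 0 < ρ) (Ψ : ℝ → ℝ → ℝ≥0∞) :
    ∫⁻ z : ℝ, Ψ (z / √(ρ ^ 2 + z ^ 2)) √(ρ ^ 2 + z ^ 2)
      = ∫⁻ u in Ioo (-1 : ℝ) 1, ENNReal.ofReal (ρ * (1 - u ^ 2) ^ (-(3 : ℝ) / 2)) *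
          Ψ u (ρ / √(1 - u ^ 2)) := by
  have hpos : ∀ u ∈ Ioo (-1 : ℝ) 1, 0 < 1 - u ^ 2 := fun u hu => by nlinarith [hu.1, hu.2]
  have hkey : ∀ u ∈ Ioo (-1 : ℝ) 1,
      √(ρ ^ 2 + (ρ * (u / √(1 - u ^ 2))) ^ 2) = ρ / √(1 - u ^ 2) := by
    intro u hu
    have h1 := hpos u hu
    rw [show ρ ^ 2 + (ρ * (u / √(1 - u ^ 2))) ^ 2 = (ρ / √(1 - u ^ 2)) ^ 2 by
      rw [mul_pow, div_pow, div_pow, Real.sq_sqrt h1.le]; field_simp; ring]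
    exact Real.sqrt_sq (by positivity)
  have hquot : ∀ u ∈ Ioo (-1 : ℝ) 1, ρ * (u / √(1 - u ^ 2)) / (ρ / √(1 - u ^ 2)) = u := by
    intro u hu
    have := Real.sqrt_pos.2 (hpos u hu)
    field_simp
  have himg : (fun u : ℝ => ρ * (u / √(1 - u ^ 2))) '' Ioo (-1 : ℝ) 1 = univ := by
    refine eq_univ_of_forall fun z => ?_
    have hs : 0 < ρ ^ 2 + z ^ 2 := by positivity
    have hs' := Real.sqrt_pos.2 hs
    have h2 : 1 - (z / √(ρ ^ 2 + z ^ 2)) ^ 2 = (ρ / √(ρ ^ 2 + z ^ 2)) ^ 2 := by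
      rw [div_pow, div_pow, Real.sq_sqrt hs.le]; field_simp; ring
    refine ⟨z / √(ρ ^ 2 + z ^ 2), ?_, ?_⟩
    · refine abs_lt.1 (abs_lt_of_sq_lt_sq ?_ zero_le_one)
      have : 0 < (ρ / √(ρ ^ 2 + z ^ 2)) ^ 2 := by positivity
      linarith
    · simp only [h2, Real.sqrt_sq (div_pos hρ hs').le]
      field_simp
  have hinj : InjOn (fun u : ℝ => ρ * (u / √(1 - u ^ 2))) (Ioo (-1 : ℝ) 1) := by
    intro u hu v hv huv
    have h3 := hquot u hu
    have h4 := hquot v hv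
    rw [← hkey u hu] at h3
    rw [← hkey v hv] at h4
    simp only at huv
    rw [← h3, ← h4, huv]
  have hder : ∀ u ∈ Ioo (-1 : ℝ) 1, HasDerivWithinAt (fun u : ℝ => ρ * (u / √(1 - u ^ 2)))
      (ρ * (1 - u ^ 2) ^ (-(3 : ℝ) / 2)) (Ioo (-1) 1) u := by
    intro u hu
    have h1 := hpos u hu
    have hs := Real.sqrt_pos.2 h1
    have hd : HasDerivAt (fun u : ℝ => √(1 - u ^ 2)) (-(2 * u) / (2 * √(1 - u ^ 2))) u := by
      refine HasDerivAt.sqrt ?_ h1.ne'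
      simpa using (hasDerivAt_pow 2 u).const_sub 1
    have h5 := ((hasDerivAt_id u).div hd hs.ne').const_mul ρ
    refine (h5.congr_deriv ?_).hasDerivWithinAt
    have h6 : (1 - u ^ 2) ^ (-(3 : ℝ) / 2) = 1 / ((1 - u ^ 2) * √(1 - u ^ 2)) := by
      rw [show -(3 : ℝ) / 2 = -(1 + 1 / 2) by norm_num, Real.rpow_neg h1.le, Real.rpow_add h1,
        Real.rpow_one, ← Real.sqrt_eq_rpow, one_div]
    rw [h6, Real.sq_sqrt h1.le]
    simp only [id]
    field_simp
    rw [Real.sq_sqrt h1.le]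
    ring
  rw [← setLIntegral_univ, ← himg,
    lintegral_image_eq_lintegral_abs_deriv_mul measurableSet_Ioo hder hinj]
  refine setLIntegral_congr_fun measurableSet_Ioo fun u hu => ?_
  have h1 := hpos u hu
  simp only [hkey u hu, hquot u hu]
  rw [abs_of_pos (by positivity)]

theorem lintegral_Ioi_comp_div {c : ℝ} (hc : 0 < c) (h : ℝ → ℝ≥0∞) :
    ∫⁻ r in Ioi (0 : ℝ), h r = ∫⁻ ρ in Ioi (0 : ℝ), ENNReal.ofReal c⁻¹ * h (ρ / c) := by
  have himg : (fun ρ : ℝ => ρ / c) '' Ioi (0 : ℝ) = Ioi 0 := by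
    ext r
    refine ⟨?_, fun hr => ⟨r * c, mul_pos hr hc, by field_simp⟩⟩
    rintro ⟨ρ, hρ, rfl⟩
    exact div_pos hρ hc
  have hd : ∀ ρ ∈ Ioi (0 : ℝ), HasDerivWithinAt (fun ρ : ℝ => ρ / c) c⁻¹ (Ioi 0) ρ := by
    intro ρ _
    simpa using ((hasDerivAt_id ρ).div_const c).hasDerivWithinAt
  conv_lhs => rw [← himg]
  rw [lintegral_image_eq_lintegral_abs_deriv_mul measurableSet_Ioi hd
    (fun a _ b _ hab => by simpa [hc.ne'] using hab)]
  simp [abs_of_pos hc]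

theorem measurable_height (k : ℕ) : Measurable (height (n := k)) := by
  unfold height
  fun_prop

/-- The distribution of the height on the unit sphere of `ℝ^{k+1}`. -/
theorem lintegral_sigma_height {k : ℕ} (hk : 1 ≤ k) {G : ℝ → ℝ≥0∞} (hG : Measurable G) :
    ∫⁻ w : S k, G (height w) ∂sigma k
      = ENNReal.ofReal (area k) *
        ∫⁻ u in Ioo (-1 : ℝ) 1, ENNReal.ofReal ((1 - u ^ 2) ^ ((k : ℝ) / 2 - 1)) * G u := by
  have : Nonempty (Fin k) := ⟨⟨0, hk⟩⟩
  set C := ∫⁻ r in Ioi (0 : ℝ), ENNReal.ofReal (r ^ k) * ENNReal.ofReal (Real.exp (-r)) with hC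
  have hC' : C = ENNReal.ofReal (Real.Gamma (k + 1)) := by
    rw [Real.Gamma_eq_integral (by positivity), ofReal_integral_eq_lintegral_ofReal
      (Real.GammaIntegral_convergent (by positivity))
      (ae_restrict_of_forall_mem measurableSet_Ioi fun r hr => by
        have := hr.out
        positivity)]
    refine setLIntegral_congr_fun measurableSet_Ioi fun r hr => ?_
    rw [← ENNReal.ofReal_mul (by have := hr.out; positivity), add_sub_cancel_right,
      Real.rpow_natCast, mul_comm]
  have hC0 : C ≠ 0 := by
    rw [hC']
    exact (ENNReal.ofReal_pos.2 (Real.Gamma_pos_of_pos (by positivity))).ne'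
  have hCt : C ≠ ∞ := by rw [hC']; exact ENNReal.ofReal_ne_top
  rw [← ENNReal.mul_left_inj hC0 hCt]
  -- Both sides are compared with the integral of `G(x_{k+1}/|x|) exp(-|x|)` over `ℝ^{k+1}`.
  set Ψ : ℝ → ℝ → ℝ≥0∞ := fun u r => G u * ENNReal.ofReal (Real.exp (-r)) with hΨ
  have hΨm : Measurable (Function.uncurry fun z r => Ψ (z / r) r) := by
    simp only [hΨ, Function.uncurry_def]
    exact (hG.comp (by fun_prop)).mul (by fun_prop)
  have hA : ∫⁻ x : E k, Ψ (x (Fin.last k) / ‖x‖) ‖x‖ = (∫⁻ w : S k, G (height w) ∂sigma k) * C := by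
    rw [lintegral_eq_lintegral_toSphere volume (Φ := fun x : E k => Ψ (x (Fin.last k) / ‖x‖) ‖x‖)
      (hΨm.comp (Measurable.prodMk (by fun_prop) (by fun_prop))),
      finrank_euclideanSpace_fin, Nat.add_sub_cancel]
    have hGh : Measurable fun w : S k => G (height w) := hG.comp (measurable_height k)
    rw [← lintegral_mul_const _ hGh, sigma]
    refine lintegral_congr fun w => ?_
    rw [hC, ← lintegral_const_mul _ (by fun_prop)]
    refine setLIntegral_congr_fun measurableSet_Ioi fun r hr => ?_
    have hr' : (0 : ℝ) < r := hr
    have h1 : (r • w.1) (Fin.last k) / ‖r • w.1‖ = height w := by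
      rw [norm_smul, norm_eq_of_mem_sphere w, Real.norm_eq_abs, abs_of_pos hr', mul_one,
        PiLp.smul_apply, smul_eq_mul, mul_div_cancel_left₀ _ hr'.ne', height]
    have h2 : ‖r • w.1‖ = r := by
      rw [norm_smul, norm_eq_of_mem_sphere w, Real.norm_eq_abs, abs_of_pos hr', mul_one]
    simp only [h1]
    rw [h2, hΨ]
    ring
  rw [← hA, lintegral_euclidean_succ (Ψ := fun z r => Ψ (z / r) r) hΨm]
  have hrad : ∀ z : ℝ, ∫⁻ y : EuclideanSpace ℝ (Fin k),
      Ψ (z / √(‖y‖ ^ 2 + z ^ 2)) √(‖y‖ ^ 2 + z ^ 2)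
      = ENNReal.ofReal (area k) *
        ∫⁻ ρ in Ioi (0 : ℝ), ENNReal.ofReal (ρ ^ (k - 1)) *
          Ψ (z / √(ρ ^ 2 + z ^ 2)) √(ρ ^ 2 + z ^ 2) := by
    intro z
    have := lintegral_norm_eq (volume : Measure (EuclideanSpace ℝ (Fin k)))
      (h := fun ρ => Ψ (z / √(ρ ^ 2 + z ^ 2)) √(ρ ^ 2 + z ^ 2))
      (hΨm.comp (Measurable.prodMk (by fun_prop) (by fun_prop)))
    rwa [toSphere_univ_euclidean hk, finrank_euclideanSpace_fin] at this
  simp_rw [hrad]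
  have hm2 : Measurable (Function.uncurry fun z ρ : ℝ => ENNReal.ofReal (ρ ^ (k - 1)) *
          Ψ (z / √(ρ ^ 2 + z ^ 2)) √(ρ ^ 2 + z ^ 2)) := by
    have : Measurable fun p : ℝ × ℝ => Ψ (p.1 / √(p.2 ^ 2 + p.1 ^ 2)) √(p.2 ^ 2 + p.1 ^ 2) :=
      hΨm.comp (Measurable.prodMk (f := fun p : ℝ × ℝ => p.1) (g := fun p => √(p.2 ^ 2 + p.1 ^ 2))
        (by fun_prop) (by fun_prop))
    exact (show Measurable fun p : ℝ × ℝ => ENNReal.ofReal (p.2 ^ (k - 1)) by fun_prop).mul this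
  rw [lintegral_const_mul _ hm2.lintegral_prod_right, mul_assoc]
  congr 1
  rw [lintegral_lintegral_swap hm2.aemeasurable]
  have hsub : ∫⁻ ρ in Ioi (0 : ℝ), ∫⁻ z : ℝ, ENNReal.ofReal (ρ ^ (k - 1)) *
        Ψ (z / √(ρ ^ 2 + z ^ 2)) √(ρ ^ 2 + z ^ 2)
      = ∫⁻ ρ in Ioi (0 : ℝ), ∫⁻ u in Ioo (-1 : ℝ) 1, ENNReal.ofReal (ρ ^ (k - 1)) *
        (ENNReal.ofReal (ρ * (1 - u ^ 2) ^ (-(3 : ℝ) / 2)) * Ψ u (ρ / √(1 - u ^ 2))) := by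
    refine setLIntegral_congr_fun measurableSet_Ioi fun ρ hρ => ?_
    rw [lintegral_const_mul' _ _ ENNReal.ofReal_ne_top, lintegral_height_subst hρ,
      lintegral_const_mul' _ _ ENNReal.ofReal_ne_top]
  have hm3 : Measurable fun p : ℝ × ℝ => ENNReal.ofReal (p.1 ^ (k - 1)) *
      (ENNReal.ofReal (p.1 * (1 - p.2 ^ 2) ^ (-(3 : ℝ) / 2)) * Ψ p.2 (p.1 / √(1 - p.2 ^ 2))) := by
    have hG2 : Measurable fun p : ℝ × ℝ => G p.2 := hG.comp measurable_snd
    have he : Measurable fun p : ℝ × ℝ =>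
        ENNReal.ofReal (Real.exp (-(p.1 / √(1 - p.2 ^ 2)))) := by fun_prop
    have h1 : Measurable fun p : ℝ × ℝ => ENNReal.ofReal (p.1 ^ (k - 1)) := by fun_prop
    have h2 : Measurable fun p : ℝ × ℝ =>
      ENNReal.ofReal (p.1 * (1 - p.2 ^ 2) ^ (-(3 : ℝ) / 2)) := by fun_prop
    exact h1.mul (h2.mul (hG2.mul he))
  have hm4 : Measurable fun u : ℝ => ENNReal.ofReal ((1 - u ^ 2) ^ ((k : ℝ) / 2 - 1)) * G u :=
    Measurable.mul (by fun_prop) hG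
  rw [hsub, lintegral_lintegral_swap hm3.aemeasurable, ← lintegral_mul_const _ hm4]
  refine setLIntegral_congr_fun measurableSet_Ioo fun u hu => ?_
  have h1 : 0 < 1 - u ^ 2 := by nlinarith [hu.1, hu.2]
  have hs := Real.sqrt_pos.2 h1
  have hsk : (1 - u ^ 2) ^ (-(3 : ℝ) / 2)
      = (1 - u ^ 2) ^ ((k : ℝ) / 2 - 1) * ((√(1 - u ^ 2))⁻¹ * (√(1 - u ^ 2) ^ k)⁻¹) := by
    rw [Real.sqrt_eq_rpow, ← Real.rpow_natCast _ k, ← Real.rpow_mul h1.le, ← Real.rpow_neg h1.le,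
      ← Real.rpow_neg h1.le, ← Real.rpow_add h1, ← Real.rpow_add h1]
    congr 1
    ring
  rw [hC, lintegral_Ioi_comp_div hs
    (fun r => ENNReal.ofReal (r ^ k) * ENNReal.ofReal (Real.exp (-r))), ← lintegral_const_mul _ (by fun_prop)]
  refine setLIntegral_congr_fun measurableSet_Ioi fun ρ hρ => ?_
  have hρ' : (0 : ℝ) < ρ := hρ
  have hk1 : ρ ^ k = ρ ^ (k - 1) * ρ := by rw [← pow_succ, Nat.sub_add_cancel hk]
  have hsc : ENNReal.ofReal (ρ ^ (k - 1)) * ENNReal.ofReal (ρ * (1 - u ^ 2) ^ (-(3 : ℝ) / 2))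
      = ENNReal.ofReal ((1 - u ^ 2) ^ ((k : ℝ) / 2 - 1)) * (ENNReal.ofReal (√(1 - u ^ 2))⁻¹ *
        ENNReal.ofReal ((ρ / √(1 - u ^ 2)) ^ k)) := by
    rw [← ENNReal.ofReal_mul (by positivity), ← ENNReal.ofReal_mul (by positivity),
      ← ENNReal.ofReal_mul (by positivity), hsk, div_pow, hk1]
    congr 1
    ring
  calc _ = ENNReal.ofReal (ρ ^ (k - 1)) * ENNReal.ofReal (ρ * (1 - u ^ 2) ^ (-(3 : ℝ) / 2)) *
        (G u * ENNReal.ofReal (Real.exp (-(ρ / √(1 - u ^ 2))))) := by rw [hΨ]; ring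
    _ = _ := by rw [hsc]; ring

/-! ### The dual transform of the Radon transform in terms of spherical means -/

/-- The linear isometry from `ℝ^{k+1}` onto the subspace `Geod.base hk θ`. -/
def frameIso {n k : ℕ} (hk : k < n) (θ : ℝ) : E k →ₗᵢ[ℝ] E n :=
  LinearMap.isometryOfOrthonormal
    ((EuclideanSpace.basisFun (Fin (k + 1)) ℝ).toBasis.constr ℝ (frame hk θ))
    (v := (EuclideanSpace.basisFun (Fin (k + 1)) ℝ).toBasis)
    (by simp)
    (by
      convert frame_orthonormal hk θ using 1
      ext1 i
      exact Module.Basis.constr_basis _ _ _ _)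

theorem frameIso_apply {n k : ℕ} (hk : k < n) (θ : ℝ) (w : E k) :
    frameIso hk θ w = ∑ i, w i • frame hk θ i := by
  change (EuclideanSpace.basisFun (Fin (k + 1)) ℝ).toBasis.constr ℝ (frame hk θ) w = _
  rw [Module.Basis.constr_apply_fintype]
  simp

theorem range_frameIso {n k : ℕ} (hk : k < n) (θ : ℝ) :
    LinearMap.range (frameIso hk θ).toLinearMap = (Geod.base hk θ).1 :=
  Module.Basis.constr_range _ ℝ

/-- The parametrization of `Geod.base hk θ`, viewed as a subsphere, by the sphere `S^k`. -/
def frameS {n k : ℕ} (hk : k < n) (θ : ℝ) (w : S k) : S n := ⟨frameIso hk θ w.1, by simp⟩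

theorem continuous_frameS {n k : ℕ} (hk : k < n) (θ : ℝ) : Continuous (frameS hk θ) :=
  ((frameIso hk θ).continuous.comp continuous_subtype_val).subtype_mk _

theorem height_frameS {n k : ℕ} (hk : k < n) {r : ℝ} (hr : r ∈ Icc (-1 : ℝ) 1) (w : S k) :
    height (frameS hk (Real.arccos r) w) = r * height w := by
  have h : ∀ i : Fin (k + 1), frame hk (Real.arccos r) i (Fin.last n)
      = if i = Fin.last k then r else 0 := by
    intro i
    have hi : ¬ n = (i : ℕ) := by have := i.2; omega
    unfold frame
    split_ifs <;> simp [pole, Fin.ext_iff, hi, Real.cos_arccos hr.1 hr.2]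
  have h2 : (∑ i, w.1 i • frame hk (Real.arccos r) i : E n) (Fin.last n)
      = ∑ i, w.1 i * frame hk (Real.arccos r) i (Fin.last n) := by simp
  rw [height, frameS]
  simp only
  rw [frameIso_apply, h2]
  simp [h, height, mul_comm]

theorem measurableEmbedding_sphereMap {V W : Type*}
    [NormedAddCommGroup V] [InnerProductSpace ℝ V] [FiniteDimensional ℝ V] [MeasurableSpace V]
    [BorelSpace V] [NormedAddCommGroup W] [InnerProductSpace ℝ W] [FiniteDimensional ℝ W]
    [MeasurableSpace W] [BorelSpace W] (L : V ≃ₗᵢ[ℝ] W) : MeasurableEmbedding (sphereMap L) := by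
  have h : Isometry (sphereMap L) := Isometry.of_dist_eq fun x y => L.isometry.dist_eq x.1 y.1
  exact h.isClosedEmbedding.measurableEmbedding

/-- The surface measure on a geodesic submanifold, in an isometric parametrization. -/
theorem geodMeasure_param {n k : ℕ} (V : Geod n k) (J : E k →ₗᵢ[ℝ] E n)
    (hJ : LinearMap.range J.toLinearMap = V.1) :
    ∃ Λ : S k → Metric.sphere (0 : V.1) 1, MeasurePreserving Λ (sigma k) (geodMeasure V) ∧
      MeasurableEmbedding Λ ∧ ∀ w, incl V.1 (Λ w) = (⟨J w.1, by simp⟩ : S n) := by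
  obtain ⟨V, hV⟩ := V
  simp only at hJ
  subst hJ
  exact ⟨sphereMap J.equivRange, measurePreserving_sphereMap _,
    measurableEmbedding_sphereMap _, fun w => rfl⟩

theorem shifted_param {n k : ℕ} (hk : k < n) (r : ℝ) (g : SO n) (ρ : K n) :
    ∃ Λ : S k → Metric.sphere (0 : (Geod.shifted hk r g ρ).1) 1,
      MeasurePreserving Λ (sigma k) (geodMeasure (Geod.shifted hk r g ρ)) ∧
      MeasurableEmbedding Λ ∧
      ∀ w, incl _ (Λ w) = rotS g (rotS ρ.1 (frameS hk (Real.arccos r) w)) := by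
  refine geodMeasure_param (Geod.shifted hk r g ρ)
    ((rot g).comp ((rot ρ.1).comp (frameIso hk (Real.arccos r)))) ?_
  simp only [Geod.shifted, Geod.act, ← range_frameIso]
  rw [← LinearMap.range_comp, ← LinearMap.range_comp]
  rfl

theorem radon_shifted {𝕜 : Type*} [RCLike 𝕜] {n k : ℕ} (hk : k < n) (f : S n → 𝕜) (r : ℝ)
    (g : SO n) (ρ : K n) : radon f (Geod.shifted hk r g ρ)
      = ∫ w, f (rotS g (rotS ρ.1 (frameS hk (Real.arccos r) w))) ∂sigma k := by
  obtain ⟨Λ, h1, h2, h3⟩ := shifted_param hk r g ρ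
  rw [radon, ← h1.integral_comp h2]
  simp only [h3]

theorem integrable_shifted_iff {𝕜 : Type*} [RCLike 𝕜] {n k : ℕ} (hk : k < n) (f : S n → 𝕜) (r : ℝ)
    (g : SO n) (ρ : K n) :
    Integrable (fun y => f (incl (Geod.shifted hk r g ρ).1 y)) (geodMeasure (Geod.shifted hk r g ρ))
      ↔ Integrable (fun w => f (rotS g (rotS ρ.1 (frameS hk (Real.arccos r) w)))) (sigma k) := by
  obtain ⟨Λ, h1, h2, h3⟩ := shifted_param hk r g ρ
  rw [← h1.integrable_comp_emb h2]
  simp only [Function.comp_def, h3]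

/-- The heights on `S^k` have the density `(1 - u²)^{k/2-1}` on `(-1, 1)`, up to the constant
`area k`. -/
theorem map_height_sigma {k : ℕ} (hk : 1 ≤ k) : (sigma k).map height
    = (volume.restrict (Ioo (-1 : ℝ) 1)).withDensity
      fun u => ENNReal.ofReal (area k * (1 - u ^ 2) ^ ((k : ℝ) / 2 - 1)) := by
  refine Measure.ext fun s hs => ?_
  have h := lintegral_sigma_height hk (G := s.indicator 1) (measurable_one.indicator hs)
  rw [Measure.map_apply (measurable_height k) hs, withDensity_apply _ hs,
    ← lintegral_indicator hs, ← lintegral_indicator_one (measurable_height k hs)]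
  refine h.trans ?_
  rw [← lintegral_const_mul' _ _ ENNReal.ofReal_ne_top]
  refine lintegral_congr fun u => ?_
  by_cases hu : u ∈ s
  · simp [hu, ENNReal.ofReal_mul (area_pos hk).le]
  · simp [hu]

theorem integral_sigma_height {F : Type*} [NormedAddCommGroup F] [NormedSpace ℝ F] {k : ℕ}
    (hk : 1 ≤ k) {φ : ℝ → F} (hφ : StronglyMeasurable φ) :
    ∫ w : S k, φ (height w) ∂sigma k
      = area k • ∫ u in Ioo (-1 : ℝ) 1, (1 - u ^ 2) ^ ((k : ℝ) / 2 - 1) • φ u := by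
  rw [← integral_map (measurable_height k).aemeasurable hφ.aestronglyMeasurable,
    map_height_sigma hk, integral_withDensity_eq_integral_toReal_smul (by fun_prop) (by simp),
    ← integral_smul]
  refine setIntegral_congr_fun measurableSet_Ioo fun u hu => ?_
  have h1 : 0 < 1 - u ^ 2 := by nlinarith [hu.1, hu.2]
  have := area_pos hk
  rw [ENNReal.toReal_ofReal (by positivity), mul_smul]

theorem lintegral_Ioo_scale {r : ℝ} (hr : 0 < r) (L : ℝ → ℝ≥0∞) :
    ∫⁻ t in Ioo (-r) r, L t = ∫⁻ u in Ioo (-1 : ℝ) 1, ENNReal.ofReal r * L (r * u) := by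
  have himg : (fun u : ℝ => r * u) '' Ioo (-1 : ℝ) 1 = Ioo (-r) r := by
    rw [Set.image_mul_left_Ioo hr]
    simp
  have hd : ∀ u ∈ Ioo (-1 : ℝ) 1, HasDerivWithinAt (fun u : ℝ => r * u) r (Ioo (-1) 1) u :=
    fun u _ => by simpa using ((hasDerivAt_id u).const_mul r).hasDerivWithinAt
  rw [← himg, lintegral_image_eq_lintegral_abs_deriv_mul measurableSet_Ioo hd
    (fun a _ b _ hab => by simpa [hr.ne'] using hab)]
  simp [abs_of_pos hr]

/-- The density of the height on `S^k` at `u`, rewritten in the height `t = r u` on a geodesic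
submanifold at the distance `arccos r`; the free factor `r` is the Jacobian of this scaling. -/
theorem rpow_kernel_scale {k : ℕ} {r u : ℝ} (hr : 0 < r) (hu : u ∈ Ioo (-1 : ℝ) 1) :
    (1 - u ^ 2) ^ ((k : ℝ) / 2 - 1)
      = r ^ (1 - (k : ℝ)) * (r * (r ^ 2 - (r * u) ^ 2) ^ ((k : ℝ) / 2 - 1)) := by
  have h1 : 0 < 1 - u ^ 2 := by nlinarith [hu.1, hu.2]
  rw [show r ^ 2 - (r * u) ^ 2 = r ^ 2 * (1 - u ^ 2) by ring, Real.mul_rpow (by positivity) h1.le,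
    ← mul_assoc, ← mul_assoc, ← Real.rpow_natCast r 2, ← Real.rpow_mul hr.le, ← Real.rpow_add_one hr.ne',
    ← Real.rpow_add hr]
  rw [show 1 - (k : ℝ) + 1 + ((2 : ℕ) : ℝ) * ((k : ℝ) / 2 - 1) = 0 by push_cast; ring,
    Real.rpow_zero, one_mul]

/-- Integration over all geodesic submanifolds at distance `arccos r` from a point, in terms of the
spherical means around this point. -/
theorem lintegral_shifted {n k : ℕ} (hk1 : 1 ≤ k) (hk : k < n) {F : S n → ℝ≥0∞} (hF : Measurable F)
    (g : SO n) {r : ℝ} (hr : r ∈ Ioc (0 : ℝ) 1) :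
    ∫⁻ ρ : K n, ∫⁻ w, F (rotS g (rotS ρ.1 (frameS hk (Real.arccos r) w))) ∂sigma k ∂haarK n
      = ENNReal.ofReal (area k * r ^ (1 - (k : ℝ))) *
        ∫⁻ t in Ioo (-r) r, ENNReal.ofReal ((r ^ 2 - t ^ 2) ^ ((k : ℝ) / 2 - 1)) *
          ∫⁻ ρ : K n, F (rotS g (rotS ρ.1 (meridian hk t))) ∂haarK n := by
  have hn : 2 ≤ n := by omega
  have hm : Measurable (Function.uncurry fun (ρ : K n) (w : S k) =>
      F (rotS g (rotS ρ.1 (frameS hk (Real.arccos r) w)))) := by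
    have h := measurable_rotS_rotS (X := K n × S k) (measurable_const (a := g)) measurable_fst
      ((continuous_frameS hk (Real.arccos r)).measurable.comp measurable_snd)
    have h' := hF.comp h
    exact h'
  have hmt : Measurable fun t : ℝ => ∫⁻ ρ : K n, F (rotS g (rotS ρ.1 (meridian hk t))) ∂haarK n := by
    have h := measurable_rotS_rotS (X := ℝ × K n) (measurable_const (a := g)) measurable_snd
      ((continuous_meridian hk).measurable.comp measurable_fst)
    exact (hF.comp h).lintegral_prod_right'
  rw [lintegral_lintegral_swap hm.aemeasurable]
  have h1 : ∀ w : S k, ∫⁻ ρ : K n, F (rotS g (rotS ρ.1 (frameS hk (Real.arccos r) w))) ∂haarK n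
      = ∫⁻ ρ : K n, F (rotS g (rotS ρ.1 (meridian hk (r * height w)))) ∂haarK n := by
    intro w
    have hw := height_mem w
    refine lintegral_haarK_congr hn F g ?_
    rw [height_frameS hk ⟨by linarith [hr.1], hr.2⟩, height_meridian hk]
    constructor <;> nlinarith [hw.1, hw.2, hr.1, hr.2]
  simp_rw [h1]
  have h2 := lintegral_sigma_height hk1 (hmt.comp (measurable_const_mul r))
  simp only [Function.comp_def] at h2
  rw [h2, lintegral_Ioo_scale hr.1, ← lintegral_const_mul' _ _ ENNReal.ofReal_ne_top,
    ← lintegral_const_mul' _ _ ENNReal.ofReal_ne_top]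
  refine setLIntegral_congr_fun measurableSet_Ioo fun u hu => ?_
  have hr0 := hr.1
  have h3 : 0 < r ^ 2 - (r * u) ^ 2 := by
    have : 0 < 1 - u ^ 2 := by nlinarith [hu.1, hu.2]
    nlinarith [mul_pos (pow_pos hr0 2) this]
  have ha := area_pos hk1
  have h4 : area k * (r ^ (1 - (k : ℝ)) * (r * (r ^ 2 - (r * u) ^ 2) ^ ((k : ℝ) / 2 - 1)))
      = area k * r ^ (1 - (k : ℝ)) * r * (r ^ 2 - (r * u) ^ 2) ^ ((k : ℝ) / 2 - 1) := by ring
  rw [rpow_kernel_scale (k := k) hr.1 hu, ← mul_assoc, ← ENNReal.ofReal_mul ha.le, h4,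
    ENNReal.ofReal_mul (by positivity), ENNReal.ofReal_mul (by positivity), mul_assoc, mul_assoc]

/-- The mean of `f` over the parallel of height `t` around the image of the pole under `g`. -/
def parallelMean {𝕜 : Type*} [RCLike 𝕜] {n k : ℕ} (hk : k < n) (f : S n → 𝕜) (g : SO n) (t : ℝ) : 𝕜 :=
  ∫ ρ : K n, f (rotS g (rotS ρ.1 (meridian hk t))) ∂haarK n

/-- The mean of `‖f‖` over the parallel of height `t` around the image of the pole under `g`. -/
def parallelNorm {𝕜 : Type*} [RCLike 𝕜] {n k : ℕ} (hk : k < n) (f : S n → 𝕜) (g : SO n) (t : ℝ) :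
    ℝ≥0∞ :=
  ∫⁻ ρ : K n, ‖f (rotS g (rotS ρ.1 (meridian hk t)))‖ₑ ∂haarK n

section
variable {𝕜 : Type*} [RCLike 𝕜] {n k : ℕ}

theorem enorm_parallelMean_le (hk : k < n) (f : S n → 𝕜) (g : SO n) (t : ℝ) :
    ‖parallelMean hk f g t‖ₑ ≤ parallelNorm hk f g t := enorm_integral_le_lintegral_enorm _

theorem measurable_parallelNorm (hk : k < n) {f : S n → 𝕜} (hf : Measurable f) (g : SO n) :
    Measurable (parallelNorm hk f g) := by
  have h := measurable_rotS_rotS (X := ℝ × K n) (measurable_const (a := g)) measurable_snd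
    ((continuous_meridian hk).measurable.comp measurable_fst)
  exact (hf.comp h).enorm.lintegral_prod_right'

theorem stronglyMeasurable_parallelMean (hk : k < n) {f : S n → 𝕜} (hf : Measurable f) (g : SO n) :
    StronglyMeasurable (parallelMean hk f g) := by
  have h := measurable_rotS_rotS (X := ℝ × K n) (measurable_const (a := g)) measurable_snd
    ((continuous_meridian hk).measurable.comp measurable_fst)
  exact (hf.comp h).stronglyMeasurable.integral_prod_right'

theorem parallelMean_neg (hk1 : 1 ≤ k) (hk : k < n) {f : S n → 𝕜} (hf : ∀ x, f (-x) = f x) (g : SO n)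
    {t : ℝ} (ht : t ∈ Icc (-1 : ℝ) 1) : parallelMean hk f g (-t) = parallelMean hk f g t := by
  have h := integral_haarK_congr (by omega : 2 ≤ n) f g (y := meridian hk (-t)) (y' := -meridian hk t) (by
    rw [height_neg, height_meridian hk ht, height_meridian hk ⟨by linarith [ht.2], by linarith [ht.1]⟩])
  simp only [rotS_neg, hf] at h
  exact h

theorem parallelNorm_neg (hk1 : 1 ≤ k) (hk : k < n) {f : S n → 𝕜} (hf : ∀ x, f (-x) = f x) (g : SO n)
    {t : ℝ} (ht : t ∈ Icc (-1 : ℝ) 1) : parallelNorm hk f g (-t) = parallelNorm hk f g t := by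
  have h := lintegral_haarK_congr (by omega : 2 ≤ n) (fun x => ‖f x‖ₑ) g
    (y := meridian hk (-t)) (y' := -meridian hk t) (by
    rw [height_neg, height_meridian hk ht, height_meridian hk ⟨by linarith [ht.2], by linarith [ht.1]⟩])
  simp only [rotS_neg, hf] at h
  exact h

theorem lintegral_Ioo_neg_of_even {r : ℝ} {L : ℝ → ℝ≥0∞}
    (hL : ∀ t ∈ Ioo 0 r, L (-t) = L t) :
    ∫⁻ t in Ioo (-r) r, L t = 2 * ∫⁻ t in Ioo 0 r, L t := by
  have h0 : Ioo (-r) r =ᵐ[volume] (Ioo (-r) 0 ∪ Ioo 0 r : Set ℝ) := by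
    have : Ioo (-r) r \ {0} = (Ioo (-r) 0 ∪ Ioo 0 r : Set ℝ) := by
      ext t
      simp only [Set.mem_sdiff, mem_Ioo, mem_singleton_iff, mem_union]
      constructor
      · rintro ⟨⟨h1, h2⟩, h3⟩
        rcases lt_or_gt_of_ne h3 with h | h
        · exact Or.inl ⟨h1, h⟩
        · exact Or.inr ⟨h, h2⟩
      · rintro (⟨h1, h2⟩ | ⟨h1, h2⟩)
        · exact ⟨⟨h1, by linarith⟩, h2.ne⟩
        · exact ⟨⟨by linarith, h2⟩, h1.ne'⟩
    rw [← this]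
    exact (sdiff_null_ae_eq_self (measure_singleton _)).symm
  rw [setLIntegral_congr h0, lintegral_union measurableSet_Ioo
    (Set.disjoint_left.2 fun t h1 h2 => absurd h1.2 (not_lt.2 h2.1.le)), two_mul]
  congr 1
  have h1 := (Measure.measurePreserving_neg (volume : Measure ℝ)).setLIntegral_comp_emb
    (MeasurableEquiv.neg ℝ).measurableEmbedding L (Ioo 0 r)
  simp only [Set.image_neg_eq_neg, Set.neg_Ioo, neg_zero] at h1
  rw [← h1]
  exact setLIntegral_congr_fun measurableSet_Ioo hL

end

section
variable {𝕜 : Type*} [RCLike 𝕜] {n k : ℕ}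

theorem integral_Ioo_neg_of_even {F : Type*} [NormedAddCommGroup F] [NormedSpace ℝ F] {r : ℝ}
    (hr : 0 < r) {L : ℝ → F} (hi : IntegrableOn L (Ioo (-r) r)) (hL : ∀ t ∈ Ioo 0 r, L (-t) = L t) :
    ∫ t in Ioo (-r) r, L t = (2 : ℝ) • ∫ t in Ioo 0 r, L t := by
  rw [← integral_Ioc_eq_integral_Ioo, ← integral_Ioc_eq_integral_Ioo,
    ← intervalIntegral.integral_of_le (by linarith), ← intervalIntegral.integral_of_le hr.le]
  have hi' : IntervalIntegrable L volume (-r) r :=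
    (intervalIntegrable_iff_integrableOn_Ioo_of_le (by linarith)).2 hi
  rw [← intervalIntegral.integral_add_adjacent_intervals (b := 0)
    (hi'.mono_set (by
      rw [uIcc_of_le (by linarith), uIcc_of_le (by linarith)]; exact Icc_subset_Icc_right hr.le))
    (hi'.mono_set (by
      rw [uIcc_of_le hr.le, uIcc_of_le (by linarith)]; exact Icc_subset_Icc_left (by linarith))),
    two_smul]
  congr 1
  rw [← neg_zero, ← intervalIntegral.integral_comp_neg, neg_zero,
    intervalIntegral.integral_of_le hr.le, intervalIntegral.integral_of_le hr.le,
    integral_Ioc_eq_integral_Ioo, integral_Ioc_eq_integral_Ioo]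
  exact setIntegral_congr_fun measurableSet_Ioo hL

/-- The kernel `(r² - t²)^{k/2-1}` of the transform that connects a spherical mean with the mean of
the Radon transform. -/
def meanKernel (k : ℕ) (r t : ℝ) : ℝ := (r ^ 2 - t ^ 2) ^ ((k : ℝ) / 2 - 1)

theorem measurable_meanKernel (k : ℕ) : Measurable (Function.uncurry (meanKernel k)) := by
  unfold meanKernel
  simp only [Function.uncurry_def]
  fun_prop

theorem meanKernel_nonneg {k : ℕ} {r t : ℝ} (h : t ∈ Ioo (-r) r) : 0 ≤ meanKernel k r t :=
  Real.rpow_nonneg (by nlinarith [h.1, h.2]) _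

/-- Changes of a function on a null set that is met by almost no parallel around a point do not
affect its Radon transform over almost all geodesic submanifolds at a fixed distance from it. -/
theorem ae_shifted_of_ae_parallel (hk1 : 1 ≤ k) (hk : k < n) {N : Set (S n)} (hN : MeasurableSet N)
    (g : SO n) {r : ℝ} (hr : r ∈ Ioc (0 : ℝ) 1)
    (h0 : ∀ᵐ t ∂volume.restrict (Ioo (-1 : ℝ) 1),
      ∫⁻ ρ : K n, N.indicator 1 (rotS g (rotS ρ.1 (meridian hk t))) ∂haarK n = 0) :
    ∀ᵐ ρ ∂haarK n, ∀ᵐ w ∂sigma k, rotS g (rotS (ρ : K n).1 (frameS hk (Real.arccos r) w)) ∉ N := by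
  have hF : Measurable (N.indicator (1 : S n → ℝ≥0∞)) := measurable_one.indicator hN
  have h1 := lintegral_shifted hk1 hk hF g hr
  have h2 : ∫⁻ t in Ioo (-r) r, ENNReal.ofReal ((r ^ 2 - t ^ 2) ^ ((k : ℝ) / 2 - 1)) *
      ∫⁻ ρ : K n, N.indicator 1 (rotS g (rotS ρ.1 (meridian hk t))) ∂haarK n = 0 := by
    refine (lintegral_congr_ae ?_).trans lintegral_zero
    filter_upwards [ae_restrict_of_ae_restrict_of_subset
      (Ioo_subset_Ioo (by linarith [hr.2]) hr.2) h0] with t ht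
    rw [ht, mul_zero]
  rw [h2, mul_zero] at h1
  have h := measurable_rotS_rotS (X := K n × S k) (measurable_const (a := g)) measurable_fst
    ((continuous_frameS hk (Real.arccos r)).measurable.comp measurable_snd)
  have hm : Measurable fun p : K n × S k =>
      N.indicator (1 : S n → ℝ≥0∞) (rotS g (rotS p.1.1 (frameS hk (Real.arccos r) p.2))) := by
    have h' := hF.comp h
    exact h'
  rw [← lintegral_prod _ hm.aemeasurable] at h1
  have h4 := (lintegral_eq_zero_iff hm).1 h1
  filter_upwards [Measure.ae_ae_of_ae_prod h4] with ρ hρ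
  filter_upwards [hρ] with w hw hwN
  simp [hwN] at hw

/-- If `f` is even and integrable along parallels with the weight `meanKernel k r`, then all the
integrals in the mean of its Radon transform at the distance `arccos r` converge, and this mean is
an Abel type transform of the spherical means. -/
theorem integral_shifted (hk1 : 1 ≤ k) (hk : k < n) {f : S n → 𝕜} (hf : Measurable f)
    (he : ∀ x, f (-x) = f x) (g : SO n) {r : ℝ} (hr : r ∈ Ioc (0 : ℝ) 1)
    (hfin : ∫⁻ t in Ioo 0 r, ENNReal.ofReal (meanKernel k r t) * parallelNorm hk f g t < ∞) :
    (∀ᵐ ρ ∂haarK n, Integrable (fun w => f (rotS g (rotS ρ.1 (frameS hk (Real.arccos r) w))))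
      (sigma k)) ∧
    Integrable (fun ρ : K n => ∫ w, f (rotS g (rotS ρ.1 (frameS hk (Real.arccos r) w))) ∂sigma k)
      (haarK n) ∧
    ∫ ρ : K n, ∫ w, f (rotS g (rotS ρ.1 (frameS hk (Real.arccos r) w))) ∂sigma k ∂haarK n
      = (2 * area k * r ^ (1 - (k : ℝ))) •
        ∫ t in Ioo 0 r, meanKernel k r t • parallelMean hk f g t := by
  have hn : 2 ≤ n := by omega
  have hsub : ∀ t ∈ Ioo 0 r, t ∈ Icc (-1 : ℝ) 1 := fun t ht =>
    ⟨by linarith [ht.1], by linarith [ht.2, hr.2]⟩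
  have hrot := measurable_rotS_rotS (X := K n × S k) (measurable_const (a := g)) measurable_fst
    ((continuous_frameS hk (Real.arccos r)).measurable.comp measurable_snd)
  have hfin2 : ∫⁻ t in Ioo (-r) r, ENNReal.ofReal (meanKernel k r t) * parallelNorm hk f g t < ∞ := by
    rw [lintegral_Ioo_neg_of_even]
    · exact ENNReal.mul_lt_top (by simp) hfin
    · intro t ht
      rw [parallelNorm_neg hk1 hk he g (hsub t ht), meanKernel, neg_sq]
      rfl
  have hint : Integrable (fun p : K n × S k =>
      f (rotS g (rotS p.1.1 (frameS hk (Real.arccos r) p.2)))) ((haarK n).prod (sigma k)) := by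
    have hm : Measurable (fun p : K n × S k =>
      f (rotS g (rotS p.1.1 (frameS hk (Real.arccos r) p.2)))) := hf.comp hrot
    refine ⟨hm.aestronglyMeasurable, ?_⟩
    rw [HasFiniteIntegral, lintegral_prod _ hm.enorm.aemeasurable]
    have h := lintegral_shifted hk1 hk hf.enorm g hr
    rw [h]
    exact ENNReal.mul_lt_top ENNReal.ofReal_lt_top hfin2
  refine ⟨hint.prod_right_ae, hint.integral_prod_left, ?_⟩
  rw [integral_integral_swap hint]
  have h1 : ∀ w : S k, ∫ ρ : K n, f (rotS g (rotS ρ.1 (frameS hk (Real.arccos r) w))) ∂haarK n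
      = parallelMean hk f g (r * height w) := by
    intro w
    have hw := height_mem w
    refine integral_haarK_congr hn f g ?_
    rw [height_frameS hk ⟨by linarith [hr.1], hr.2⟩, height_meridian hk]
    constructor <;> nlinarith [hw.1, hw.2, hr.1, hr.2]
  simp_rw [h1]
  have hsm := stronglyMeasurable_parallelMean hk hf g
  have h2 := integral_sigma_height hk1 (hsm.comp_measurable (measurable_const_mul r))
  simp only [Function.comp_def] at h2
  have hmk : Measurable (meanKernel k r) := (measurable_meanKernel k).comp measurable_prodMk_left
  have hI : IntegrableOn (fun t => meanKernel k r t • parallelMean hk f g t) (Ioo (-r) r) := by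
    refine ⟨(hmk.stronglyMeasurable.smul hsm).aestronglyMeasurable, ?_⟩
    refine lt_of_le_of_lt ?_ hfin2
    refine setLIntegral_mono' measurableSet_Ioo fun t ht => ?_
    rw [enorm_smul, Real.enorm_of_nonneg (meanKernel_nonneg ht)]
    gcongr
    exact enorm_parallelMean_le hk f g t
  have h3 : ∫ t in Ioo (-r) r, meanKernel k r t • parallelMean hk f g t
      = r • ∫ u in Ioo (-1 : ℝ) 1, meanKernel k r (r * u) • parallelMean hk f g (r * u) := by
    rw [← integral_Ioc_eq_integral_Ioo, ← integral_Ioc_eq_integral_Ioo,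
      ← intervalIntegral.integral_of_le (by linarith [hr.1]),
      ← intervalIntegral.integral_of_le (by norm_num),
      intervalIntegral.integral_comp_mul_left (fun t => meanKernel k r t • parallelMean hk f g t)
        hr.1.ne', smul_smul, mul_inv_cancel₀ hr.1.ne', one_smul]
    simp
  have h4 := integral_Ioo_neg_of_even hr.1 hI (by
    intro t ht
    rw [parallelMean_neg hk1 hk he g (hsub t ht), meanKernel, neg_sq]
    rfl)
  rw [h2]
  have h5 : ∫ u in Ioo (-1 : ℝ) 1, (1 - u ^ 2) ^ ((k : ℝ) / 2 - 1) • parallelMean hk f g (r * u)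
      = r ^ (1 - (k : ℝ)) • ∫ t in Ioo (-r) r, meanKernel k r t • parallelMean hk f g t := by
    rw [h3, smul_smul, ← integral_smul]
    refine setIntegral_congr_fun measurableSet_Ioo fun u hu => ?_
    rw [rpow_kernel_scale (k := k) hr.1 hu, smul_smul, meanKernel, mul_assoc]
  rw [h5, h4, smul_smul, smul_smul]
  congr 1
  ring

end

/-! ### Composition of Abel type kernels -/

/-- The beta integral on an arbitrary interval. -/
theorem lintegral_beta {α : ℝ} (hα : 0 < α) {a b : ℝ} (hab : a < b) :
    ∫⁻ v in Ioo a b, ENNReal.ofReal (((b - v) * (v - a)) ^ (α - 1))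
      = ENNReal.ofReal (ProbabilityTheory.beta α α * (b - a) ^ (2 * α - 1)) := by
  have hc : 0 < b - a := sub_pos.2 hab
  have hB := ProbabilityTheory.beta_pos hα hα
  have h01 : ∫⁻ x in Ioo (0 : ℝ) 1, ENNReal.ofReal (x ^ (α - 1) * (1 - x) ^ (α - 1))
      = ENNReal.ofReal (ProbabilityTheory.beta α α) := by
    have h := ProbabilityTheory.lintegral_betaPDF_eq_one hα hα
    rw [ProbabilityTheory.lintegral_betaPDF] at h
    have h2 : ∀ x ∈ Ioo (0 : ℝ) 1,
        ENNReal.ofReal (1 / ProbabilityTheory.beta α α * x ^ (α - 1) * (1 - x) ^ (α - 1))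
        = ENNReal.ofReal (1 / ProbabilityTheory.beta α α) *
          ENNReal.ofReal (x ^ (α - 1) * (1 - x) ^ (α - 1)) := by
      intro x hx
      rw [← ENNReal.ofReal_mul (by positivity), mul_assoc]
    rw [setLIntegral_congr_fun measurableSet_Ioo h2,
      lintegral_const_mul' _ _ ENNReal.ofReal_ne_top] at h
    calc _ = ENNReal.ofReal (ProbabilityTheory.beta α α) *
          (ENNReal.ofReal (1 / ProbabilityTheory.beta α α) *
          ∫⁻ x in Ioo (0 : ℝ) 1, ENNReal.ofReal (x ^ (α - 1) * (1 - x) ^ (α - 1))) := by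
            rw [← mul_assoc, ← ENNReal.ofReal_mul hB.le, mul_one_div_cancel hB.ne',
              ENNReal.ofReal_one, one_mul]
      _ = _ := by rw [h, mul_one]
  have himg : (fun x : ℝ => a + (b - a) * x) '' Ioo (0 : ℝ) 1 = Ioo a b := by
    rw [show (fun x : ℝ => a + (b - a) * x) = (fun y => a + y) ∘ (fun x => (b - a) * x) from rfl,
      image_comp, Set.image_mul_left_Ioo hc]
    simp
  have hd : ∀ x ∈ Ioo (0 : ℝ) 1,
      HasDerivWithinAt (fun x : ℝ => a + (b - a) * x) (b - a) (Ioo 0 1) x := fun x _ => by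
    simpa using (((hasDerivAt_id x).const_mul (b - a)).const_add a).hasDerivWithinAt
  rw [← himg, lintegral_image_eq_lintegral_abs_deriv_mul measurableSet_Ioo hd
    (fun x _ y _ hxy => by simpa [hc.ne'] using hxy), ENNReal.ofReal_mul hB.le, ← h01, mul_comm,
    ← lintegral_const_mul' _ _ ENNReal.ofReal_ne_top]
  refine setLIntegral_congr_fun measurableSet_Ioo fun x hx => ?_
  have h1 : 0 < 1 - x := sub_pos.2 hx.2
  have h0 := hx.1
  rw [abs_of_pos hc, ← ENNReal.ofReal_mul hc.le, ← ENNReal.ofReal_mul (by positivity)]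
  congr 1
  rw [show (b - (a + (b - a) * x)) * (a + (b - a) * x - a) = (b - a) ^ 2 * (x * (1 - x)) by ring,
    Real.mul_rpow (by positivity) (by positivity), Real.mul_rpow h0.le h1.le,
    ← Real.rpow_natCast (b - a) 2, ← Real.rpow_mul hc.le, ← mul_assoc, mul_comm (b - a),
    ← Real.rpow_add_one hc.ne']
  congr 2
  push_cast
  ring

/-- The composition of two kernels of order `α` in the variables `s²`, `r²`, `t²` is a kernel of
order `2α`. -/
theorem lintegral_kernel_sq {α : ℝ} (hα : 0 < α) {s t : ℝ} (ht : 0 ≤ t) (hts : t < s) :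
    ∫⁻ r in Ioo t s, ENNReal.ofReal ((s ^ 2 - r ^ 2) ^ (α - 1) * (r ^ 2 - t ^ 2) ^ (α - 1) * r)
      = ENNReal.ofReal (ProbabilityTheory.beta α α / 2 * (s ^ 2 - t ^ 2) ^ (2 * α - 1)) := by
  have hs : 0 < s := ht.trans_lt hts
  have h := lintegral_beta hα (pow_lt_pow_left₀ hts ht two_ne_zero)
  have himg : (fun r : ℝ => r ^ 2) '' Ioo t s = Ioo (t ^ 2) (s ^ 2) := by
    ext v
    constructor
    · rintro ⟨r, hr, rfl⟩
      exact ⟨pow_lt_pow_left₀ hr.1 ht two_ne_zero,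
        pow_lt_pow_left₀ hr.2 (ht.trans hr.1.le) two_ne_zero⟩
    · intro hv
      exact ⟨√v, ⟨Real.lt_sqrt_of_sq_lt hv.1, (Real.sqrt_lt' hs).2 hv.2⟩,
        Real.sq_sqrt ((sq_nonneg t).trans hv.1.le)⟩
  rw [← himg, lintegral_image_eq_lintegral_abs_deriv_mul (f' := fun r => 2 * r) measurableSet_Ioo
    (fun r _ => by simpa using (hasDerivAt_pow 2 r).hasDerivWithinAt)
    (fun x hx y hy hxy => (pow_left_inj₀ (ht.trans hx.1.le) (ht.trans hy.1.le) two_ne_zero).1 hxy)]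
    at h
  have h2 : ENNReal.ofReal 2 * ∫⁻ r in Ioo t s,
      ENNReal.ofReal ((s ^ 2 - r ^ 2) ^ (α - 1) * (r ^ 2 - t ^ 2) ^ (α - 1) * r)
      = ENNReal.ofReal 2 *
        ENNReal.ofReal (ProbabilityTheory.beta α α / 2 * (s ^ 2 - t ^ 2) ^ (2 * α - 1)) := by
    rw [← ENNReal.ofReal_mul zero_le_two, ← mul_assoc, mul_div_cancel₀ _ two_ne_zero, ← h,
      ← lintegral_const_mul' _ _ ENNReal.ofReal_ne_top]
    refine setLIntegral_congr_fun measurableSet_Ioo fun r hr => ?_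
    have hr0 : 0 < r := ht.trans_lt hr.1
    have h3 : 0 < s ^ 2 - r ^ 2 := by nlinarith [hr.2]
    have h4 : 0 < r ^ 2 - t ^ 2 := by nlinarith [hr.1]
    rw [abs_of_pos (by positivity), ← ENNReal.ofReal_mul zero_le_two,
      ← ENNReal.ofReal_mul (by positivity), Real.mul_rpow h3.le h4.le]
    congr 1
    ring
  exact (ENNReal.mul_right_inj (by simp) ENNReal.ofReal_ne_top).1 h2

/-- The composition of two kernels with the weight `r^{2-2α}` is a kernel of order `2α` in `s - t`.
The substitution `w = r - st/r` gives `(s² - r²)(r² - t²) = r² ((s - t)² - w²)`. Since `r ↦ st/r`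
maps the interval `(t, s)` onto itself and `w` to `-w`, the missing Jacobian `1 + st/r²` is obtained
by symmetrization. -/
theorem lintegral_kernel_inv {α : ℝ} (hα : 0 < α) {s t : ℝ} (ht : 0 < t) (hts : t < s) :
    ∫⁻ r in Ioo t s,
      ENNReal.ofReal ((s ^ 2 - r ^ 2) ^ (α - 1) * (r ^ 2 - t ^ 2) ^ (α - 1) * r ^ (2 - 2 * α))
      = ENNReal.ofReal (ProbabilityTheory.beta α α / 2 * (2 * (s - t)) ^ (2 * α - 1)) := by
  have hs : 0 < s := ht.trans hts
  set G : ℝ → ℝ≥0∞ := fun w =>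
    ENNReal.ofReal (((s - t - w) * (w - -(s - t))) ^ (α - 1)) with hG
  have hGe : ∀ w, G (-w) = G w := fun w => by simp only [hG]; congr 2; ring
  have hpos : ∀ r ∈ Ioo t s, 0 < r := fun r hr => ht.trans hr.1
  have h1 : ∀ r ∈ Ioo t s,
      ENNReal.ofReal ((s ^ 2 - r ^ 2) ^ (α - 1) * (r ^ 2 - t ^ 2) ^ (α - 1) * r ^ (2 - 2 * α))
      = G (r - s * t / r) := by
    intro r hr
    have hr0 := hpos r hr
    have h3 : 0 < s ^ 2 - r ^ 2 := by nlinarith [hr.2]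
    have h4 : 0 < r ^ 2 - t ^ 2 := by nlinarith [hr.1]
    simp only [hG]
    rw [show (s - t - (r - s * t / r)) * (r - s * t / r - -(s - t))
      = (s ^ 2 - r ^ 2) * (r ^ 2 - t ^ 2) * (r ^ 2)⁻¹ by field_simp; ring,
      Real.mul_rpow (by positivity) (by positivity), Real.mul_rpow h3.le h4.le,
      ← Real.rpow_natCast r 2, ← Real.rpow_neg hr0.le, ← Real.rpow_mul hr0.le]
    congr 3
    push_cast
    ring
  rw [setLIntegral_congr_fun measurableSet_Ioo h1]
  have hinv : (fun r : ℝ => s * t / r) '' Ioo t s = Ioo t s := by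
    have hmaps : ∀ r ∈ Ioo t s, s * t / r ∈ Ioo t s := fun r hr =>
      ⟨(lt_div_iff₀ (hpos r hr)).2 (by nlinarith [hr.2]),
        (div_lt_iff₀ (hpos r hr)).2 (by nlinarith [hr.1])⟩
    refine Subset.antisymm (image_subset_iff.2 hmaps) fun r hr => ⟨_, hmaps r hr, ?_⟩
    have := hpos r hr
    field_simp
  have hsymm : ∫⁻ r in Ioo t s, G (r - s * t / r)
      = ∫⁻ r in Ioo t s, ENNReal.ofReal (s * t / r ^ 2) * G (r - s * t / r) := by
    conv_lhs => rw [← hinv]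
    rw [lintegral_image_eq_lintegral_abs_deriv_mul (f' := fun r => -(s * t) / r ^ 2)
      measurableSet_Ioo (fun r hr => by
        have h := ((hasDerivAt_const r (s * t)).div (hasDerivAt_id r) (hpos r hr).ne')
        refine (h.congr_deriv ?_).hasDerivWithinAt
        simp)
      (fun x hx y hy hxy => by
        have hx0 := hpos x hx
        have hy0 := hpos y hy
        rw [div_eq_div_iff hx0.ne' hy0.ne'] at hxy
        exact (mul_left_cancel₀ (by positivity) hxy).symm)]
    refine setLIntegral_congr_fun measurableSet_Ioo fun r hr => ?_
    have hr0 := hpos r hr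
    rw [neg_div, abs_neg, abs_of_pos (by positivity), ← hGe]
    congr 2
    field_simp
    ring
  have himg : (fun r : ℝ => r - s * t / r) '' Ioo t s = Ioo (-(s - t)) (s - t) := by
    have hmono : StrictMonoOn (fun r : ℝ => r - s * t / r) (Icc t s) := by
      intro x hx y hy hxy
      have hx0 : 0 < x := ht.trans_le hx.1
      have := div_lt_div_of_pos_left (mul_pos hs ht) hx0 hxy
      simp only
      linarith
    have hcont : ContinuousOn (fun r : ℝ => r - s * t / r) (Icc t s) :=
      continuousOn_id.sub (continuousOn_const.div continuousOn_id
        fun x hx => (ht.trans_le hx.1).ne')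
    have ht' : t - s * t / t = -(s - t) := by field_simp; ring
    have hs' : s - s * t / s = s - t := by field_simp
    refine Subset.antisymm ?_ ?_
    · rintro _ ⟨r, hr, rfl⟩
      rw [← ht', ← hs']
      exact ⟨hmono ⟨le_rfl, hts.le⟩ ⟨hr.1.le, hr.2.le⟩ hr.1,
        hmono ⟨hr.1.le, hr.2.le⟩ ⟨hts.le, le_rfl⟩ hr.2⟩
    · have := intermediate_value_Ioo hts.le hcont
      rwa [ht', hs'] at this
  have hinj : InjOn (fun r : ℝ => r - s * t / r) (Ioo t s) := by
    intro x hx y hy hxy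
    have hx0 := hpos x hx
    have hy0 := hpos y hy
    by_contra hne
    rcases lt_or_gt_of_ne hne with h | h
    · have := div_lt_div_of_pos_left (mul_pos hs ht) hx0 h
      simp only at hxy
      linarith
    · have := div_lt_div_of_pos_left (mul_pos hs ht) hy0 h
      simp only at hxy
      linarith
  have hJ : ∫⁻ w in Ioo (-(s - t)) (s - t), G w
      = ENNReal.ofReal 2 * ∫⁻ r in Ioo t s, G (r - s * t / r) := by
    rw [← himg, lintegral_image_eq_lintegral_abs_deriv_mul (f' := fun r => 1 + s * t / r ^ 2)
      measurableSet_Ioo (fun r hr => by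
        have h := (hasDerivAt_id r).sub
          ((hasDerivAt_const r (s * t)).div (hasDerivAt_id r) (hpos r hr).ne')
        refine (h.congr_deriv ?_).hasDerivWithinAt
        simp [neg_div]) hinj]
    have hsplit : ∀ r ∈ Ioo t s, ENNReal.ofReal |1 + s * t / r ^ 2| * G (r - s * t / r)
        = G (r - s * t / r) + ENNReal.ofReal (s * t / r ^ 2) * G (r - s * t / r) := by
      intro r hr
      have hr0 := hpos r hr
      rw [abs_of_pos (by positivity), ENNReal.ofReal_add zero_le_one (by positivity), add_mul,
        ENNReal.ofReal_one, one_mul]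
    have hmG : Measurable fun r : ℝ => G (r - s * t / r) := by
      simp only [hG]
      fun_prop
    rw [setLIntegral_congr_fun measurableSet_Ioo hsplit, lintegral_add_left hmG, ← hsymm]
    simp [two_mul]
  have hbeta := lintegral_beta hα (show -(s - t) < s - t by linarith)
  rw [show s - t - -(s - t) = 2 * (s - t) by ring] at hbeta
  refine (ENNReal.mul_right_inj (by simp) (ENNReal.ofReal_ne_top (r := 2))).1 ?_
  rw [← hJ, hbeta, ← ENNReal.ofReal_mul zero_le_two]
  congr 1
  ring

/-- Tonelli's theorem on the triangle `0 < t < r < s`. -/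
theorem lintegral_triangle {s : ℝ} {q : ℝ → ℝ → ℝ≥0∞} (hq : Measurable (Function.uncurry q))
    {L : ℝ → ℝ≥0∞} (hL : Measurable L) {κ : ℝ → ℝ≥0∞}
    (hκ : ∀ t ∈ Ioo 0 s, ∫⁻ r in Ioo t s, q r t = κ t) :
    ∫⁻ r in Ioo 0 s, ∫⁻ t in Ioo 0 r, q r t * L t = ∫⁻ t in Ioo 0 s, κ t * L t := by
  have hset : MeasurableSet {p : ℝ × ℝ | p.2 < p.1} := measurableSet_lt measurable_snd measurable_fst
  set Q : ℝ × ℝ → ℝ≥0∞ := {p : ℝ × ℝ | p.2 < p.1}.indicator fun p => q p.1 p.2 * L p.2 with hQ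
  have hQm : Measurable Q :=
    (Measurable.mul hq (hL.comp measurable_snd)).indicator hset
  have h1 : ∀ r ∈ Ioo 0 s, ∫⁻ t in Ioo 0 r, q r t * L t = ∫⁻ t in Ioo 0 s, Q (r, t) := by
    intro r hr
    have : ∀ t, Q (r, t) = (Iio r).indicator (fun t => q r t * L t) t := fun t => by
      simp [hQ, indicator]
    simp_rw [this]
    rw [setLIntegral_indicator measurableSet_Iio]
    congr 2
    ext t
    simp only [mem_Ioo, mem_inter_iff, mem_Iio]
    exact ⟨fun h => ⟨h.2, h.1, h.2.trans hr.2⟩, fun h => ⟨h.2.1, h.1⟩⟩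
  rw [setLIntegral_congr_fun measurableSet_Ioo h1,
    lintegral_lintegral_swap (f := fun r t => Q (r, t)) hQm.aemeasurable]
  refine setLIntegral_congr_fun measurableSet_Ioo fun t ht => ?_
  have : ∀ r, Q (r, t) = (Ioi t).indicator (fun r => q r t * L t) r := fun r => by
    simp [hQ, indicator]
  have hqt : Measurable fun r => q r t := hq.comp measurable_prodMk_right
  simp_rw [this]
  rw [setLIntegral_indicator measurableSet_Ioi, ← hκ t ht, ← lintegral_mul_const _ hqt]
  congr 2
  ext r
  simp only [mem_Ioo, mem_inter_iff, mem_Ioi]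
  exact ⟨fun h => ⟨h.1, h.2.2⟩, fun h => ⟨h.1, ht.1.trans h.1, h.2⟩⟩

/-- Fubini's theorem on the triangle `0 < t < r < s`. -/
theorem integral_triangle {𝕜 : Type*} [RCLike 𝕜] {s : ℝ} {q : ℝ → ℝ → ℝ}
    (hq : Measurable (Function.uncurry q)) (hq0 : ∀ r ∈ Ioo 0 s, ∀ t ∈ Ioo 0 r, 0 ≤ q r t)
    {M : ℝ → 𝕜} (hM : Measurable M) {κ : ℝ → ℝ} (hκ0 : ∀ t ∈ Ioo 0 s, 0 ≤ κ t)
    (hκ : ∀ t ∈ Ioo 0 s, ∫⁻ r in Ioo t s, ENNReal.ofReal (q r t) = ENNReal.ofReal (κ t))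
    (hfin : ∫⁻ t in Ioo 0 s, ENNReal.ofReal (κ t) * ‖M t‖ₑ < ∞) :
    IntegrableOn (fun r => ∫ t in Ioo 0 r, q r t • M t) (Ioo 0 s) ∧
    ∫ r in Ioo 0 s, ∫ t in Ioo 0 r, q r t • M t = ∫ t in Ioo 0 s, κ t • M t := by
  have hset : MeasurableSet {p : ℝ × ℝ | p.2 < p.1} := measurableSet_lt measurable_snd measurable_fst
  set Q : ℝ × ℝ → 𝕜 := {p : ℝ × ℝ | p.2 < p.1}.indicator fun p => q p.1 p.2 • M p.2 with hQ
  have hQm : Measurable Q :=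
    (Measurable.smul hq (hM.comp measurable_snd)).indicator hset
  have hQr : ∀ r t, Q (r, t) = (Iio r).indicator (fun t => q r t • M t) t := fun r t => by
    simp [hQ, indicator]
  have hQt : ∀ t r, Q (r, t) = (Ioi t).indicator (fun r => q r t • M t) r := fun t r => by
    simp [hQ, indicator]
  have hIr : ∀ r ∈ Ioo 0 s, Ioo 0 s ∩ Iio r = Ioo 0 r := fun r hr => by
    ext t
    simp only [mem_Ioo, mem_inter_iff, mem_Iio]
    exact ⟨fun h => ⟨h.1.1, h.2⟩, fun h => ⟨⟨h.1, h.2.trans hr.2⟩, h.2⟩⟩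
  have hIt : ∀ t ∈ Ioo 0 s, Ioo 0 s ∩ Ioi t = Ioo t s := fun t ht => by
    ext r
    simp only [mem_Ioo, mem_inter_iff, mem_Ioi]
    exact ⟨fun h => ⟨h.2, h.1.2⟩, fun h => ⟨⟨ht.1.trans h.1, h.2⟩, h.1⟩⟩
  have hint : Integrable Q ((volume.restrict (Ioo 0 s)).prod (volume.restrict (Ioo 0 s))) := by
    refine ⟨hQm.aestronglyMeasurable, ?_⟩
    rw [HasFiniteIntegral, lintegral_prod _ hQm.enorm.aemeasurable]
    have h1 : ∀ r ∈ Ioo 0 s, ∫⁻ t in Ioo 0 s, ‖Q (r, t)‖ₑ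
        = ∫⁻ t in Ioo 0 r, ENNReal.ofReal (q r t) * ‖M t‖ₑ := by
      intro r hr
      simp_rw [hQr, enorm_indicator_eq_indicator_enorm]
      rw [setLIntegral_indicator measurableSet_Iio, inter_comm, hIr r hr]
      refine setLIntegral_congr_fun measurableSet_Ioo fun t ht => ?_
      rw [enorm_smul, Real.enorm_of_nonneg (hq0 r hr t ht)]
    rw [setLIntegral_congr_fun measurableSet_Ioo h1,
      lintegral_triangle (q := fun r t => ENNReal.ofReal (q r t)) hq.ennreal_ofReal hM.enorm hκ]
    exact hfin
  have h2 : ∀ r ∈ Ioo 0 s, ∫ t in Ioo 0 s, Q (r, t) = ∫ t in Ioo 0 r, q r t • M t := by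
    intro r hr
    simp_rw [hQr]
    rw [setIntegral_indicator measurableSet_Iio, hIr r hr]
  have h3 : ∀ t ∈ Ioo 0 s, ∫ r in Ioo 0 s, Q (r, t) = κ t • M t := by
    intro t ht
    have hqt : Measurable fun r => q r t := hq.comp measurable_prodMk_right
    simp_rw [hQt]
    rw [setIntegral_indicator measurableSet_Ioi, hIt t ht, integral_smul_const,
      integral_eq_lintegral_of_nonneg_ae
        (ae_restrict_of_forall_mem measurableSet_Ioo fun r hr =>
          hq0 r ⟨ht.1.trans hr.1, hr.2⟩ t ⟨ht.1, hr.1⟩)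
        hqt.aestronglyMeasurable, hκ t ht, ENNReal.toReal_ofReal (hκ0 t ht)]
  refine ⟨?_, ?_⟩
  · exact (integrableOn_congr_fun h2 measurableSet_Ioo).1 hint.integral_prod_left
  · rw [← setIntegral_congr_fun measurableSet_Ioo h2, integral_integral_swap
      (f := fun r t => Q (r, t)) hint]
    exact setIntegral_congr_fun measurableSet_Ioo h3

/-! ### Fractional integrals of the dual transform as transforms of spherical means -/

section
variable {𝕜 : Type*} [RCLike 𝕜] {n k : ℕ}

/-- Around the image of the pole under `g`, the function `f` may be replaced by the even measurable
function `f'`, which is integrable along parallels: almost no parallel meets the set where the two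
functions differ in a set of positive measure. -/
structure AdmissibleAt (hk : k < n) (f f' : S n → 𝕜) (g : SO n) : Prop where
  measurable : Measurable f'
  even : ∀ x, f' (-x) = f' x
  exists_null : ∃ N : Set (S n), MeasurableSet N ∧ (∀ x, x ∉ N → f x = f' x) ∧
    ∀ᵐ t ∂volume.restrict (Ioo (-1 : ℝ) 1),
      ∫⁻ ρ : K n, N.indicator 1 (rotS g (rotS ρ.1 (meridian hk t))) ∂haarK n = 0
  lt_top : ∫⁻ t in Ioo (0 : ℝ) 1, parallelNorm hk f' g t < ∞

namespace AdmissibleAt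
variable {hk : k < n} {f f' : S n → 𝕜} {g : SO n}

/-- The mean of the Radon transform at the distance `arccos r` is a transform of the spherical means,
whenever the latter are integrable against the kernel. -/
theorem shiftedDual_radon (h : AdmissibleAt hk f f' g) (hk1 : 1 ≤ k) {r : ℝ}
    (hr : r ∈ Ioc (0 : ℝ) 1)
    (hfin : ∫⁻ t in Ioo 0 r, ENNReal.ofReal (meanKernel k r t) * parallelNorm hk f' g t < ∞) :
    ((∀ᵐ ρ ∂haarK n, Integrable
      (fun y => f (incl (Geod.shifted hk r g ρ).1 y)) (geodMeasure (Geod.shifted hk r g ρ))) ∧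
    Integrable (fun ρ : K n => radon f (Geod.shifted hk r g ρ)) (haarK n)) ∧
    shiftedDual hk (radon f) g r = (2 * area k * r ^ (1 - (k : ℝ))) •
        ∫ t in Ioo 0 r, meanKernel k r t • parallelMean hk f' g t := by
  obtain ⟨N, hN, hff, h0⟩ := h.exists_null
  obtain ⟨h1, h2, h3⟩ := integral_shifted hk1 hk h.measurable h.even g hr hfin
  have hae := ae_shifted_of_ae_parallel hk1 hk hN g hr h0
  have heq : ∀ᵐ ρ ∂haarK n, (fun w => f (rotS g (rotS (ρ : K n).1 (frameS hk (Real.arccos r) w))))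
      =ᵐ[sigma k] fun w => f' (rotS g (rotS ρ.1 (frameS hk (Real.arccos r) w))) := by
    filter_upwards [hae] with ρ hρ
    filter_upwards [hρ] with w hw using hff _ hw
  have heq2 : (fun ρ : K n => radon f (Geod.shifted hk r g ρ)) =ᵐ[haarK n]
      fun ρ => ∫ w, f' (rotS g (rotS ρ.1 (frameS hk (Real.arccos r) w))) ∂sigma k := by
    filter_upwards [heq] with ρ hρ
    rw [radon_shifted, integral_congr_ae hρ]
  refine ⟨⟨?_, h2.congr heq2.symm⟩, ?_⟩
  · filter_upwards [h1, heq] with ρ hρ1 hρ2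
    rw [integrable_shifted_iff]
    exact hρ1.congr hρ2.symm
  · rw [shiftedDual, integral_congr_ae heq2, h3]

theorem measurable_norm (h : AdmissibleAt hk f f' g) : Measurable (parallelNorm hk f' g) :=
  measurable_parallelNorm hk h.measurable g

theorem measurable_mean (h : AdmissibleAt hk f f' g) : Measurable (parallelMean hk f' g) :=
  (stronglyMeasurable_parallelMean hk h.measurable g).measurable

theorem lintegral_mul_lt_top (h : AdmissibleAt hk f f' g) {s : ℝ} (hs : s ≤ 1) {κ : ℝ → ℝ} {C : ℝ}
    (hκ : ∀ t ∈ Ioo 0 s, κ t ≤ C) :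
    ∫⁻ t in Ioo 0 s, ENNReal.ofReal (κ t) * parallelNorm hk f' g t < ∞ := by
  refine lt_of_le_of_lt (b := ENNReal.ofReal C * ∫⁻ t in Ioo (0 : ℝ) 1, parallelNorm hk f' g t) ?_
    (ENNReal.mul_lt_top ENNReal.ofReal_lt_top h.lt_top)
  rw [← lintegral_const_mul' _ _ ENNReal.ofReal_ne_top]
  refine (setLIntegral_mono' measurableSet_Ioo fun t ht => ?_).trans
    (lintegral_mono_set (Ioo_subset_Ioo_right hs))
  gcongr
  exact hκ t ht

/-- The transforms of the spherical means converge absolutely for almost all `r`, since they are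
integrable after one more transform, which composes to a bounded kernel. -/
theorem ae_lt_top (h : AdmissibleAt hk f f' g) (hk1 : 1 ≤ k) :
    ∀ᵐ r ∂volume.restrict (Ioo (0 : ℝ) 1),
      ∫⁻ t in Ioo 0 r, ENNReal.ofReal (meanKernel k r t) * parallelNorm hk f' g t < ∞ := by
  have hα : (0 : ℝ) < (k : ℝ) / 2 := by positivity
  have hB := ProbabilityTheory.beta_pos hα hα
  have hk1' : (1 : ℝ) ≤ k := by exact_mod_cast hk1
  set q : ℝ → ℝ → ℝ≥0∞ := fun r t => ENNReal.ofReal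
    (((1 : ℝ) ^ 2 - r ^ 2) ^ ((k : ℝ) / 2 - 1) * (r ^ 2 - t ^ 2) ^ ((k : ℝ) / 2 - 1) * r) with hq
  have hqm : Measurable (Function.uncurry q) := by
    simp only [hq, Function.uncurry_def]
    fun_prop
  have htri := lintegral_triangle (s := 1) hqm h.measurable_norm
    (fun t ht => lintegral_kernel_sq hα ht.1.le ht.2)
  have hfin := h.lintegral_mul_lt_top (le_refl 1)
    (κ := fun t => ProbabilityTheory.beta (k / 2) (k / 2) / 2 *
      ((1 : ℝ) ^ 2 - t ^ 2) ^ (2 * ((k : ℝ) / 2) - 1)) (C := ProbabilityTheory.beta (k / 2) (k / 2) / 2)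
    (by
      intro t ht
      refine mul_le_of_le_one_right (by positivity) (Real.rpow_le_one ?_ ?_ ?_)
      · nlinarith [ht.1, ht.2]
      · nlinarith [ht.1, ht.2]
      · linarith)
  rw [← htri] at hfin
  have hm : Measurable fun r => ∫⁻ t in Ioo 0 r, q r t * parallelNorm hk f' g t := by
    have hset : MeasurableSet {p : ℝ × ℝ | p.2 ∈ Ioo 0 p.1} :=
      (measurableSet_lt measurable_const measurable_snd).inter
        (measurableSet_lt measurable_snd measurable_fst)
    have h2 : Measurable fun p : ℝ × ℝ => q p.1 p.2 * parallelNorm hk f' g p.2 :=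
      hqm.mul (h.measurable_norm.comp measurable_snd)
    have h3 := (h2.indicator hset).lintegral_prod_right' (ν := volume)
    convert h3 using 2 with r
    rw [← lintegral_indicator measurableSet_Ioo]
    rfl
  filter_upwards [MeasureTheory.ae_lt_top hm hfin.ne, ae_restrict_mem measurableSet_Ioo] with r hr hr1
  have hr0 := hr1.1
  have hc : 0 < ((1 : ℝ) ^ 2 - r ^ 2) ^ ((k : ℝ) / 2 - 1) * r :=
    mul_pos (Real.rpow_pos_of_pos (by nlinarith [hr1.2]) _) hr0
  have heq : ∫⁻ t in Ioo 0 r, q r t * parallelNorm hk f' g t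
      = ENNReal.ofReal (((1 : ℝ) ^ 2 - r ^ 2) ^ ((k : ℝ) / 2 - 1) * r) *
        ∫⁻ t in Ioo 0 r, ENNReal.ofReal (meanKernel k r t) * parallelNorm hk f' g t := by
    rw [← lintegral_const_mul' _ _ ENNReal.ofReal_ne_top]
    refine setLIntegral_congr_fun measurableSet_Ioo fun t ht => ?_
    simp only [hq]
    rw [← mul_assoc, ← ENNReal.ofReal_mul hc.le, meanKernel]
    congr 2
    ring
  rw [heq] at hr
  exact ENNReal.lt_top_of_mul_ne_top_right hr.ne (ENNReal.ofReal_pos.2 hc).ne'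

theorem dualRadonConverges (h : AdmissibleAt hk f f' g) (hk1 : 1 ≤ k) :
    DualRadonConverges hk f g := by
  filter_upwards [h.ae_lt_top hk1, ae_restrict_mem measurableSet_Ioo] with r hr hr1
  exact (h.shiftedDual_radon hk1 ⟨hr1.1, hr1.2.le⟩ hr).1

/-- A fractional integral of the mean of the Radon transform, evaluated by means of the composition
`κ` of its kernel with the kernel that connects spherical means with this mean. -/
theorem ekIntegral_eq (h : AdmissibleAt hk f f' g) (hk1 : 1 ≤ k) {s : ℝ} (hs : s ∈ Ioo (0 : ℝ) 1)
    (m : ℕ) {κ : ℝ → ℝ} {C : ℝ} (hκ0 : ∀ t ∈ Ioo 0 s, 0 ≤ κ t) (hκC : ∀ t ∈ Ioo 0 s, κ t ≤ C)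
    (hκ : ∀ t ∈ Ioo 0 s, ∫⁻ r in Ioo t s, ENNReal.ofReal ((s ^ 2 - r ^ 2) ^ ((k : ℝ) / 2 - 1) *
      (r ^ 2 - t ^ 2) ^ ((k : ℝ) / 2 - 1) * (r ^ m * r ^ (1 - (k : ℝ)))) = ENNReal.ofReal (κ t)) :
    EKConverges k m (shiftedDual hk (radon f) g) s ∧
    ekIntegral k m (shiftedDual hk (radon f) g) s
      = (2 * area k) • ∫ t in (0 : ℝ)..s, κ t • parallelMean hk f' g t := by
  set q : ℝ → ℝ → ℝ := fun r t => (s ^ 2 - r ^ 2) ^ ((k : ℝ) / 2 - 1) *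
      (r ^ 2 - t ^ 2) ^ ((k : ℝ) / 2 - 1) * (r ^ m * r ^ (1 - (k : ℝ))) with hq
  have hqm : Measurable (Function.uncurry q) := by
    simp only [hq, Function.uncurry_def]
    fun_prop
  have hq0 : ∀ r ∈ Ioo 0 s, ∀ t ∈ Ioo 0 r, 0 ≤ q r t := by
    intro r hr t ht
    have hr0 := hr.1
    have h3 : 0 ≤ s ^ 2 - r ^ 2 := by nlinarith [hr.2]
    have h4 : 0 ≤ r ^ 2 - t ^ 2 := by nlinarith [ht.1, ht.2]
    positivity
  have hfin : ∫⁻ t in Ioo 0 s, ENNReal.ofReal (κ t) * ‖parallelMean hk f' g t‖ₑ < ∞ := by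
    refine lt_of_le_of_lt (lintegral_mono fun t => ?_) (h.lintegral_mul_lt_top hs.2.le hκC)
    gcongr
    exact enorm_parallelMean_le hk f' g t
  obtain ⟨hI, hE⟩ := integral_triangle hqm hq0 h.measurable_mean hκ0 hκ hfin
  have hae : (fun r => ((s ^ 2 - r ^ 2) ^ ((k : ℝ) / 2 - 1) * r ^ m) •
      shiftedDual hk (radon f) g r) =ᵐ[volume.restrict (Ioo 0 s)]
      fun r => (2 * area k) • ∫ t in Ioo 0 r, q r t • parallelMean hk f' g t := by
    filter_upwards [ae_restrict_of_ae_restrict_of_subset (Ioo_subset_Ioo_right hs.2.le)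
      (h.ae_lt_top hk1), ae_restrict_mem measurableSet_Ioo] with r hr hr1
    rw [(h.shiftedDual_radon hk1 ⟨hr1.1, hr1.2.le.trans hs.2.le⟩ hr).2, smul_smul, ← integral_smul,
      ← integral_smul]
    refine setIntegral_congr_fun measurableSet_Ioo fun t ht => ?_
    simp only [smul_smul, hq, meanKernel]
    congr 1
    ring
  have hI2 := (hI.smul (2 * area k)).congr hae.symm
  refine ⟨(intervalIntegrable_iff_integrableOn_Ioo_of_le hs.1.le).2 hI2, ?_⟩
  rw [ekIntegral, intervalIntegral.integral_of_le hs.1.le, intervalIntegral.integral_of_le hs.1.le,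
    integral_Ioc_eq_integral_Ioo, integral_Ioc_eq_integral_Ioo, integral_congr_ae hae,
    integral_smul, hE]

theorem Gamma_natCast_eq {j : ℕ} (hj : 1 ≤ j) : Real.Gamma j = (j - 1).factorial := by
  obtain ⟨i, rfl⟩ := Nat.exists_eq_add_of_le' hj
  simpa using Real.Gamma_nat_eq_factorial i

theorem area_mul_beta (hk1 : 1 ≤ k) :
    area k * ProbabilityTheory.beta (k / 2) (k / 2)
      = 2 * Real.pi ^ ((k : ℝ) / 2) * Real.Gamma ((k : ℝ) / 2) / (k - 1).factorial := by
  have hα : (0 : ℝ) < (k : ℝ) / 2 := by positivity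
  have hG := Real.Gamma_pos_of_pos hα
  rw [area, ProbabilityTheory.beta, add_halves, Gamma_natCast_eq hk1]
  field_simp

/-- With the weight `r^k`, the fractional integral of the mean of the Radon transform is a transform
of the spherical means with the polynomial kernel `(s² - t²)^{k-1}`. -/
theorem ek_formula_sq (h : AdmissibleAt hk f f' g) (hk1 : 1 ≤ k) {s : ℝ} (hs : s ∈ Ioo (0 : ℝ) 1) :
    EKConverges k k (shiftedDual hk (radon f) g) s ∧
    (Real.pi ^ (-(k : ℝ) / 2) / Real.Gamma ((k : ℝ) / 2)) •
      ekIntegral k k (shiftedDual hk (radon f) g) s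
      = (2 / ((k - 1).factorial : ℝ)) •
        ∫ t in (0 : ℝ)..s, (s ^ 2 - t ^ 2) ^ (k - 1) • parallelMean hk f' g t := by
  have hα : (0 : ℝ) < (k : ℝ) / 2 := by positivity
  have hG := Real.Gamma_pos_of_pos hα
  have hB := ProbabilityTheory.beta_pos hα hα
  have hs0 := hs.1
  have hle : ∀ t ∈ Ioo 0 s, 0 ≤ s ^ 2 - t ^ 2 ∧ s ^ 2 - t ^ 2 ≤ 1 := fun t ht =>
    ⟨by nlinarith [ht.1, ht.2], by nlinarith [ht.1, hs.2, hs.1]⟩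
  obtain ⟨h1, h2⟩ := h.ekIntegral_eq hk1 hs k
    (κ := fun t => ProbabilityTheory.beta (k / 2) (k / 2) / 2 * (s ^ 2 - t ^ 2) ^ (k - 1))
    (C := ProbabilityTheory.beta (k / 2) (k / 2) / 2)
    (fun t ht => mul_nonneg (by positivity) (pow_nonneg (hle t ht).1 _))
    (fun t ht => mul_le_of_le_one_right (by positivity) (pow_le_one₀ (hle t ht).1 (hle t ht).2))
    (fun t ht => by
      rw [← Real.rpow_natCast _ (k - 1), Nat.cast_sub hk1, Nat.cast_one,
        show (k : ℝ) - 1 = 2 * ((k : ℝ) / 2) - 1 by ring, ← lintegral_kernel_sq hα ht.1.le ht.2]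
      refine setLIntegral_congr_fun measurableSet_Ioo fun r hr => ?_
      have hr0 : 0 < r := ht.1.trans hr.1
      rw [← Real.rpow_natCast r k, ← Real.rpow_add hr0, add_sub_cancel, Real.rpow_one])
  refine ⟨h1, ?_⟩
  simp_rw [h2, mul_smul]
  rw [intervalIntegral.integral_smul, smul_smul, smul_smul, smul_smul]
  congr 1
  have hab := area_mul_beta hk1
  rw [show Real.pi ^ (-(k : ℝ) / 2) = (Real.pi ^ ((k : ℝ) / 2))⁻¹ by
    rw [neg_div, Real.rpow_neg Real.pi_pos.le]]
  have hpi := Real.rpow_pos_of_pos Real.pi_pos ((k : ℝ) / 2)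
  calc _ = (Real.pi ^ ((k : ℝ) / 2))⁻¹ / Real.Gamma ((k : ℝ) / 2) *
        (area k * ProbabilityTheory.beta (k / 2) (k / 2)) := by ring
    _ = _ := by rw [hab]; field_simp

/-- With the weight `r`, the fractional integral of the mean of the Radon transform is a transform of
the spherical means with the kernel `(s - t)^{k-1}`, that is, their `k`-fold primitive. -/
theorem ek_formula_linear (h : AdmissibleAt hk f f' g) (hk1 : 1 ≤ k) {s : ℝ}
    (hs : s ∈ Ioo (0 : ℝ) 1) :
    EKConverges k 1 (shiftedDual hk (radon f) g) s ∧
    ((2 : ℝ) ^ (-(k : ℝ)) * Real.pi ^ (-(k : ℝ) / 2) / Real.Gamma ((k : ℝ) / 2)) •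
      ekIntegral k 1 (shiftedDual hk (radon f) g) s
      = (1 / ((k - 1).factorial : ℝ)) •
        ∫ t in (0 : ℝ)..s, (s - t) ^ (k - 1) • parallelMean hk f' g t := by
  have hα : (0 : ℝ) < (k : ℝ) / 2 := by positivity
  have hG := Real.Gamma_pos_of_pos hα
  have hB := ProbabilityTheory.beta_pos hα hα
  have hs0 := hs.1
  have hle : ∀ t ∈ Ioo 0 s, 0 ≤ s - t ∧ s - t ≤ 1 := fun t ht =>
    ⟨by linarith [ht.2], by linarith [ht.1, hs.2]⟩
  obtain ⟨h1, h2⟩ := h.ekIntegral_eq hk1 hs 1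
    (κ := fun t => ProbabilityTheory.beta (k / 2) (k / 2) / 2 * 2 ^ (k - 1) * (s - t) ^ (k - 1))
    (C := ProbabilityTheory.beta (k / 2) (k / 2) / 2 * 2 ^ (k - 1))
    (fun t ht => mul_nonneg (by positivity) (pow_nonneg (hle t ht).1 _))
    (fun t ht => mul_le_of_le_one_right (by positivity) (pow_le_one₀ (hle t ht).1 (hle t ht).2))
    (fun t ht => by
      rw [mul_assoc, ← mul_pow, ← Real.rpow_natCast _ (k - 1), Nat.cast_sub hk1, Nat.cast_one,
        show (k : ℝ) - 1 = 2 * ((k : ℝ) / 2) - 1 by ring, ← lintegral_kernel_inv hα ht.1 ht.2]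
      refine setLIntegral_congr_fun measurableSet_Ioo fun r hr => ?_
      have hr0 : 0 < r := ht.1.trans hr.1
      rw [pow_one, mul_comm r, ← Real.rpow_add_one hr0.ne',
        show 1 - (k : ℝ) + 1 = 2 - 2 * ((k : ℝ) / 2) by ring])
  refine ⟨h1, ?_⟩
  simp_rw [h2, mul_smul]
  rw [intervalIntegral.integral_smul, intervalIntegral.integral_smul, smul_smul, smul_smul,
    smul_smul, smul_smul]
  congr 1
  have hab := area_mul_beta hk1
  rw [show Real.pi ^ (-(k : ℝ) / 2) = (Real.pi ^ ((k : ℝ) / 2))⁻¹ by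
    rw [neg_div, Real.rpow_neg Real.pi_pos.le], Real.rpow_neg zero_le_two, Real.rpow_natCast]
  have hpi := Real.rpow_pos_of_pos Real.pi_pos ((k : ℝ) / 2)
  have h2k : (2 : ℝ) ^ k = 2 ^ (k - 1) * 2 := by rw [← pow_succ, Nat.sub_add_cancel hk1]
  calc _ = ((2 : ℝ) ^ k)⁻¹ * (Real.pi ^ ((k : ℝ) / 2))⁻¹ / Real.Gamma ((k : ℝ) / 2) * 2 ^ (k - 1) *
        (area k * ProbabilityTheory.beta (k / 2) (k / 2)) := by ring
    _ = _ := by rw [hab, h2k]; field_simp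

/-- For even `k`, the mean of the Radon transform is itself a transform of the spherical means with
a polynomial kernel. -/
theorem even_formula (h : AdmissibleAt hk f f' g) (hk1 : 1 ≤ k) (hev : Even k) {s : ℝ}
    (hs : s ∈ Ioo (0 : ℝ) 1) :
    (1 / (2 * Real.pi ^ ((k : ℝ) / 2))) • (s ^ (k - 1) • shiftedDual hk (radon f) g s)
      = (2 / ((k / 2 - 1).factorial : ℝ)) •
        ∫ t in (0 : ℝ)..s, (s ^ 2 - t ^ 2) ^ (k / 2 - 1) • parallelMean hk f' g t := by
  obtain ⟨j, hj⟩ := hev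
  have hj1 : 1 ≤ j := by omega
  have hk2 : k / 2 = j := by omega
  have hkj : (k : ℝ) / 2 = j := by rw [hj]; push_cast; ring
  have hker : ∀ t, meanKernel k s t = (s ^ 2 - t ^ 2) ^ (j - 1) := by
    intro t
    rw [meanKernel, hkj, ← Real.rpow_natCast _ (j - 1), Nat.cast_sub hj1, Nat.cast_one]
  have hs0 := hs.1
  have hfin := h.lintegral_mul_lt_top hs.2.le (κ := meanKernel k s) (C := 1) (fun t ht => by
    rw [hker]
    exact pow_le_one₀ (by nlinarith [ht.1, ht.2]) (by nlinarith [ht.1, hs.2]))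
  rw [(h.shiftedDual_radon hk1 ⟨hs.1, hs.2.le⟩ hfin).2, intervalIntegral.integral_of_le hs.1.le,
    integral_Ioc_eq_integral_Ioo, hk2, smul_smul, smul_smul]
  simp_rw [hker]
  congr 1
  have hpi := Real.rpow_pos_of_pos Real.pi_pos (j : ℝ)
  have hsp : s ^ (1 - (k : ℝ)) = (s ^ (k - 1))⁻¹ := by
    rw [← Real.rpow_natCast, Nat.cast_sub hk1, Nat.cast_one, ← Real.rpow_neg hs0.le, neg_sub]
  rw [area, hkj, Gamma_natCast_eq hj1, hsp]
  field_simp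

end AdmissibleAt

end

/-! ### Differentiation of transforms with polynomial kernels -/

section
variable {F : Type*} [NormedAddCommGroup F] [NormedSpace ℝ F]

/-- The transform of `m` with the kernel `(q s - q t)^j`. -/
def powIntegral (q : ℝ → ℝ) (j : ℕ) (m : ℝ → F) (s : ℝ) : F :=
  ∫ t in (0 : ℝ)..s, (q s - q t) ^ j • m t

theorem powIntegral_succ {q : ℝ → ℝ} (hq : Continuous q) (j : ℕ) {m : ℝ → F} (hm : Continuous m)
    (s : ℝ) : powIntegral q (j + 1) m s
      = q s • powIntegral q j m s - powIntegral q j (fun t => q t • m t) s := by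
  simp only [powIntegral]
  rw [← intervalIntegral.integral_smul, ← intervalIntegral.integral_sub
    (by apply Continuous.intervalIntegrable; fun_prop)
    (by apply Continuous.intervalIntegrable; fun_prop)]
  refine intervalIntegral.integral_congr fun t _ => ?_
  simp only [smul_smul, ← sub_smul]
  congr 1
  ring

theorem hasDerivAt_powIntegral_zero [CompleteSpace F] (q : ℝ → ℝ) {m : ℝ → F} (hm : Continuous m) (s : ℝ) :
    HasDerivAt (powIntegral q 0 m) (m s) s := by
  have h := intervalIntegral.integral_hasDerivAt_right (hm.intervalIntegrable 0 s)
    (hm.stronglyMeasurableAtFilter _ _) hm.continuousAt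
  refine h.congr_of_eventuallyEq (Eventually.of_forall fun s => ?_)
  simp only [powIntegral, pow_zero, one_smul]

theorem hasDerivAt_powIntegral [CompleteSpace F] {q q' : ℝ → ℝ} (hq : ∀ s, HasDerivAt q (q' s) s) (j : ℕ)
    {m : ℝ → F} (hm : Continuous m) (s : ℝ) :
    HasDerivAt (powIntegral q (j + 1) m) (((j + 1 : ℝ) * q' s) • powIntegral q j m s) s := by
  have hqc : Continuous q := continuous_iff_continuousAt.2 fun s => (hq s).continuousAt
  induction j generalizing m with
  | zero =>
    have h1 := (hq s).smul (hasDerivAt_powIntegral_zero q hm s)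
    have h2 := hasDerivAt_powIntegral_zero q (hqc.smul hm) s
    refine ((h1.sub h2).congr_of_eventuallyEq
      (Eventually.of_forall (powIntegral_succ hqc 0 hm))).congr_deriv ?_
    simp
  | succ j ih =>
    have h1 := (hq s).smul (ih hm)
    have h2 := ih (hqc.smul hm)
    refine ((h1.sub h2).congr_of_eventuallyEq
      (Eventually.of_forall (powIntegral_succ hqc (j + 1) hm))).congr_deriv ?_
    have h3 := powIntegral_succ hqc j hm s
    have h4 : powIntegral q j (q • m) s = q s • powIntegral q j m s - powIntegral q (j + 1) m s := by
      rw [h3, sub_sub_cancel]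
      rfl
    rw [h4]
    push_cast
    module

theorem contDiff_powIntegral [CompleteSpace F] {q q' : ℝ → ℝ} (hq : ∀ s, HasDerivAt q (q' s) s)
    (hq' : ∀ j : ℕ, ContDiff ℝ j q') (j : ℕ) {m : ℝ → F} (hm : Continuous m) :
    ContDiff ℝ (j + 1 : ℕ) (powIntegral q j m) := by
  induction j with
  | zero =>
    have hd : deriv (powIntegral q 0 m) = m :=
      funext fun s => (hasDerivAt_powIntegral_zero q hm s).deriv
    rw [zero_add, Nat.cast_one, contDiff_one_iff_deriv, hd]
    exact ⟨fun s => (hasDerivAt_powIntegral_zero q hm s).differentiableAt, hm⟩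
  | succ j ih =>
    have hd : deriv (powIntegral q (j + 1) m)
        = fun s => ((j + 1 : ℝ) * q' s) • powIntegral q j m s :=
      funext fun s => (hasDerivAt_powIntegral hq j hm s).deriv
    rw [Nat.cast_succ (j + 1), contDiff_succ_iff_deriv, hd]
    exact ⟨fun s => (hasDerivAt_powIntegral hq j hm s).differentiableAt, by simp,
      (contDiff_const.mul (hq' _)).smul ih⟩

theorem iteratedDeriv_powIntegral [CompleteSpace F] (j : ℕ) {m : ℝ → F} (hm : Continuous m) :
    iteratedDeriv (j + 1) (fun s => (1 / (j.factorial : ℝ)) • powIntegral id j m s) = m := by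
  induction j with
  | zero =>
    rw [zero_add, iteratedDeriv_one]
    funext s
    simpa using (hasDerivAt_powIntegral_zero id hm s).deriv
  | succ j ih =>
    rw [iteratedDeriv_succ']
    refine (congrArg _ (funext fun s => ?_)).trans ih
    have h := (hasDerivAt_powIntegral (q := id) (q' := fun _ => 1) (fun s => hasDerivAt_id s) j hm
      s).const_smul (1 / ((j + 1).factorial : ℝ))
    refine (h.deriv).trans ?_
    rw [smul_smul, Nat.factorial_succ]
    congr 1
    push_cast
    field_simp

theorem eqOn_eulerD_iterate {U : Set ℝ} (hU : IsOpen U) (j : ℕ) {h₁ h₂ : ℝ → F}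
    (h : EqOn h₁ h₂ U) : EqOn (eulerD^[j] h₁) (eulerD^[j] h₂) U := by
  induction j generalizing h₁ h₂ with
  | zero => exact h
  | succ j ih =>
    refine ih fun s hs => ?_
    simp only [eulerD]
    rw [(h.eventuallyEq_of_mem (hU.mem_nhds hs)).deriv_eq]

theorem hasDerivAt_sq (s : ℝ) : HasDerivAt (fun s : ℝ => s ^ 2) (2 * s) s := by
  simpa using hasDerivAt_pow 2 s

/-- The kernels `(s² - t²)^j` are lowered by the operator `(1/2s) ∂/∂s`; its last application leaves
the factor `s⁻¹`. -/
theorem eulerD_iterate_powIntegral [CompleteSpace F] (j : ℕ) {m : ℝ → F} (hm : Continuous m) :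
    EqOn (eulerD^[j + 1] fun s => (2 / (j.factorial : ℝ)) • powIntegral (· ^ 2) j m s)
      (fun s => s⁻¹ • m s) (Ioi 0) := by
  induction j with
  | zero =>
    intro s hs
    have h := (hasDerivAt_powIntegral_zero (· ^ 2) hm s).const_smul (2 : ℝ)
    simp only [zero_add, Function.iterate_one, eulerD, Nat.factorial_zero, Nat.cast_one, div_one]
    refine (congrArg _ h.deriv).trans ?_
    have hs0 : s ≠ 0 := ne_of_gt hs
    rw [smul_smul]
    congr 1
    field_simp
  | succ j ih =>
    rw [Function.iterate_succ_apply]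
    refine (eqOn_eulerD_iterate isOpen_Ioi (j + 1) fun s hs => ?_).trans ih
    have hs0 : s ≠ 0 := ne_of_gt hs
    have h := (hasDerivAt_powIntegral hasDerivAt_sq j hm s).const_smul
      (2 / ((j + 1).factorial : ℝ))
    simp only [eulerD]
    refine (congrArg _ h.deriv).trans ?_
    rw [smul_smul, smul_smul, Nat.factorial_succ]
    congr 1
    push_cast
    field_simp

end

/-! ### Spherical means of continuous functions -/

section
variable {𝕜 : Type*} [RCLike 𝕜] {n k : ℕ}

theorem parallelMean_one (hk : k < n) (f : S n → 𝕜) (g : SO n) :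
    parallelMean hk f g 1 = f (rotS g (poleS n)) := by
  have h : ∀ ρ : K n, rotS ρ.1 (poleS n) = poleS n := fun ρ => Subtype.ext ρ.2
  simp [parallelMean, meridian_one, h]

theorem continuous_comp_rotS_rotS {f : S n → 𝕜} (hf : Continuous f) (g : SO n) (y : S n) :
    Continuous fun ρ : K n => f (rotS g (rotS ρ.1 y)) := by
  have h : Continuous fun ρ : K n => rotS ρ.1 y := continuous_subtype_val.rotS continuous_const
  have h2 : Continuous fun ρ : K n => rotS g (rotS ρ.1 y) := continuous_const.rotS h
  exact hf.comp h2

theorem integrable_comp_rotS_rotS {f : S n → 𝕜} (hf : Continuous f) (g : SO n) (y : S n) :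
    Integrable (fun ρ : K n => f (rotS g (rotS ρ.1 y))) (haarK n) :=
  (continuous_comp_rotS_rotS hf g y).integrable_of_hasCompactSupport
    (HasCompactSupport.of_compactSpace _)

/-- The spherical means of a continuous function depend continuously on the height, uniformly in
the center. -/
theorem eventually_norm_parallelMean_sub_le (hk : k < n) {f : S n → 𝕜} (hf : Continuous f) (t : ℝ)
    {ε : ℝ} (hε : 0 < ε) :
    ∀ᶠ t' in 𝓝 t, ∀ g : SO n, ‖parallelMean hk f g t' - parallelMean hk f g t‖ ≤ ε := by
  obtain ⟨δ, hδ, h⟩ := Metric.uniformContinuous_iff.1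
    (CompactSpace.uniformContinuous_of_continuous hf) ε hε
  filter_upwards [(continuous_meridian hk).continuousAt (Metric.ball_mem_nhds (meridian hk t) hδ)]
    with t' ht' g
  rw [parallelMean, parallelMean, ← integral_sub (integrable_comp_rotS_rotS hf g _)
    (integrable_comp_rotS_rotS hf g _)]
  refine (norm_integral_le_of_norm_le_const (C := ε) (Eventually.of_forall fun ρ => ?_)).trans
    (by simp)
  rw [← dist_eq_norm]
  refine (h ?_).le
  rw [(isometry_rotS g).dist_eq, (isometry_rotS ρ.1).dist_eq]
  exact ht'

theorem continuous_parallelMean (hk : k < n) {f : S n → 𝕜} (hf : Continuous f) (g : SO n) :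
    Continuous (parallelMean hk f g) := by
  refine continuous_iff_continuousAt.2 fun t => Metric.tendsto_nhds.2 fun ε hε => ?_
  filter_upwards [eventually_norm_parallelMean_sub_le hk hf t (half_pos hε)] with t' ht'
  rw [dist_eq_norm]
  exact (ht' g).trans_lt (half_lt_self hε)

theorem exists_norm_le_of_continuous {f : S n → 𝕜} (hf : Continuous f) :
    ∃ C : ℝ, 0 ≤ C ∧ ∀ x, ‖f x‖ ≤ C := by
  obtain ⟨C, hC⟩ := isCompact_univ.exists_bound_of_continuousOn hf.continuousOn
  exact ⟨max C 0, le_max_right _ _, fun x => (hC x (mem_univ x)).trans (le_max_left _ _)⟩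

theorem norm_parallelMean_le (hk : k < n) {f : S n → 𝕜} {C : ℝ} (hC : ∀ x, ‖f x‖ ≤ C) (g : SO n)
    (t : ℝ) : ‖parallelMean hk f g t‖ ≤ C :=
  (norm_integral_le_of_norm_le_const (Eventually.of_forall fun _ => hC _)).trans (by simp)

theorem admissibleAt_of_continuous (hk : k < n) {f : S n → 𝕜} (hf : Continuous f)
    (he : ∀ x, f (-x) = f x) (g : SO n) : AdmissibleAt hk f f g where
  measurable := hf.measurable
  even := he
  exists_null := ⟨∅, MeasurableSet.empty, fun _ _ => rfl, by simp⟩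
  lt_top := by
    obtain ⟨C, -, hC⟩ := exists_norm_le_of_continuous hf
    refine lt_of_le_of_lt (b := ∫⁻ _ in Ioo (0 : ℝ) 1, ENNReal.ofReal C)
      (lintegral_mono fun t => ?_) (by simp)
    refine (lintegral_mono (g := fun _ => ENNReal.ofReal C) fun ρ => ?_).trans (by simp)
    rw [← ofReal_norm]
    exact ENNReal.ofReal_le_ofReal (hC _)

/-- The spherical means of a continuous function converge uniformly to the function. -/
theorem tendstoUniformly_parallelMean (hk : k < n) {τ : S n → SO n}
    (hτ : ∀ x, rotS (τ x) (poleS n) = x) {f : S n → 𝕜} (hf : Continuous f) :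
    TendstoUniformly (fun s x => parallelMean hk f (τ x) s) f (𝓝[<] 1) := by
  refine Metric.tendstoUniformly_iff.2 fun ε hε => ?_
  filter_upwards [nhdsWithin_le_nhds
    (eventually_norm_parallelMean_sub_le hk hf 1 (half_pos hε))] with s hs x
  have h := hs (τ x)
  rw [parallelMean_one, hτ] at h
  rw [dist_comm, dist_eq_norm]
  exact h.trans_lt (half_lt_self hε)

theorem tendstoUniformly_inv_smul_parallelMean (hk : k < n) {τ : S n → SO n}
    (hτ : ∀ x, rotS (τ x) (poleS n) = x) {f : S n → 𝕜} (hf : Continuous f) :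
    TendstoUniformly (fun s x => s⁻¹ • parallelMean hk f (τ x) s) f (𝓝[<] 1) := by
  obtain ⟨C, hC0, hC⟩ := exists_norm_le_of_continuous hf
  have h1 : TendstoUniformly (fun (s : ℝ) (x : S n) => (s⁻¹ - 1) • parallelMean hk f (τ x) s)
      (fun _ => (0 : 𝕜)) (𝓝[<] 1) := by
    have h0 : Tendsto (fun s : ℝ => |s⁻¹ - 1| * C) (𝓝[<] 1) (𝓝 0) := by
      have : ContinuousAt (fun s : ℝ => |s⁻¹ - 1| * C) 1 :=
        (((continuousAt_inv₀ one_ne_zero).sub continuousAt_const).abs).mul continuousAt_const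
      have h := this.tendsto
      simp only [inv_one, sub_self, abs_zero, zero_mul] at h
      exact h.mono_left nhdsWithin_le_nhds
    refine Metric.tendstoUniformly_iff.2 fun ε hε => ?_
    filter_upwards [h0.eventually (gt_mem_nhds hε)] with s hs x
    rw [dist_zero_left, norm_smul, Real.norm_eq_abs]
    exact (mul_le_mul_of_nonneg_left (norm_parallelMean_le hk hC _ _) (abs_nonneg _)).trans_lt hs
  have h2 := h1.add (tendstoUniformly_parallelMean hk hτ hf)
  intro u hu
  filter_upwards [h2 u hu] with s hs x
  have h3 := hs x
  simp only [Pi.add_apply, sub_smul, one_smul, sub_add_cancel, zero_add] at h3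
  exact h3

theorem uniformlyRecovers_eulerD (hk : k < n) {τ : S n → SO n}
    (hτ : ∀ x, rotS (τ x) (poleS n) = x) {f : S n → 𝕜} (hf : Continuous f) {j : ℕ} (hj : 1 ≤ j)
    {F : S n → ℝ → 𝕜} (hF : ∀ x, ∀ s ∈ Ioo (0 : ℝ) 1, F x s = (2 / ((j - 1).factorial : ℝ)) •
      ∫ t in (0 : ℝ)..s, (s ^ 2 - t ^ 2) ^ (j - 1) • parallelMean hk f (τ x) t) :
    UniformlyRecovers f j (eulerD^[j]) F := by
  obtain ⟨i, rfl⟩ := Nat.exists_eq_add_of_le' hj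
  simp only [Nat.add_sub_cancel] at hF
  have hF' : ∀ x, EqOn (F x) (fun s => (2 / (i.factorial : ℝ)) •
      powIntegral (· ^ 2) i (parallelMean hk f (τ x)) s) (Ioo 0 1) := hF
  have hm := fun x => continuous_parallelMean hk hf (τ x)
  refine ⟨fun x => ContDiffOn.congr (ContDiff.contDiffOn ?_) (hF' x), ?_⟩
  · exact (contDiff_powIntegral hasDerivAt_sq (fun j => contDiff_const.mul contDiff_id) i
      (hm x)).const_smul _
  · intro u hu
    filter_upwards [Ioo_mem_nhdsLT zero_lt_one,
      tendstoUniformly_inv_smul_parallelMean hk hτ hf u hu] with s hs hu x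
    have h1 := eqOn_eulerD_iterate isOpen_Ioo (i + 1) (hF' x) hs
    rw [h1.trans (eulerD_iterate_powIntegral i (hm x) hs.1)]
    exact hu x

theorem uniformlyRecovers_iteratedDeriv (hk : k < n) {τ : S n → SO n}
    (hτ : ∀ x, rotS (τ x) (poleS n) = x) {f : S n → 𝕜} (hf : Continuous f) {j : ℕ} (hj : 1 ≤ j)
    {F : S n → ℝ → 𝕜} (hF : ∀ x, ∀ s ∈ Ioo (0 : ℝ) 1, F x s = (1 / ((j - 1).factorial : ℝ)) •
      ∫ t in (0 : ℝ)..s, (s - t) ^ (j - 1) • parallelMean hk f (τ x) t) :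
    UniformlyRecovers f j (iteratedDeriv j) F := by
  obtain ⟨i, rfl⟩ := Nat.exists_eq_add_of_le' hj
  simp only [Nat.add_sub_cancel] at hF
  have hF' : ∀ x, EqOn (F x) (fun s => (1 / (i.factorial : ℝ)) •
      powIntegral id i (parallelMean hk f (τ x)) s) (Ioo 0 1) := hF
  have hm := fun x => continuous_parallelMean hk hf (τ x)
  refine ⟨fun x => ContDiffOn.congr (ContDiff.contDiffOn ?_) (hF' x), ?_⟩
  · exact (contDiff_powIntegral (fun s => hasDerivAt_id s) (fun j => contDiff_const) i
      (hm x)).const_smul _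
  · intro u hu
    filter_upwards [Ioo_mem_nhdsLT zero_lt_one, tendstoUniformly_parallelMean hk hτ hf u hu]
      with s hs hu x
    have h1 := (hF' x).iteratedDeriv_of_isOpen isOpen_Ioo (i + 1) hs
    rw [iteratedDeriv_powIntegral i (hm x)] at h1
    rw [h1]
    exact hu x

end

/-! ### Integrals of curves in `L^p` -/

section
variable {X 𝕜 : Type*} [MeasurableSpace X] [RCLike 𝕜] {μ : Measure X} [IsFiniteMeasure μ] {p : ℝ≥0∞}

/-- A bound `μ(X)^{1-1/p}` for the norm of the inclusion of `L^p` into `L^1`. -/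
def inclusionBound (μ : Measure X) (p : ℝ≥0∞) : ℝ :=
  (μ univ ^ (1 / (1 : ℝ≥0∞).toReal - 1 / p.toReal)).toReal

theorem lintegral_enorm_Lp_le [hp : Fact (1 ≤ p)] (u : Lp 𝕜 p μ) :
    ∫⁻ x, ‖u x‖ₑ ∂μ ≤ ENNReal.ofReal (inclusionBound μ p * ‖u‖) := by
  have hexp : 0 ≤ 1 / (1 : ℝ≥0∞).toReal - 1 / p.toReal := by
    rcases eq_or_ne p ∞ with rfl | hp'
    · simp
    · have h1 : 1 ≤ p.toReal := by
        simpa using (ENNReal.toReal_le_toReal ENNReal.one_ne_top hp').2 hp.out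
      rw [ENNReal.toReal_one, div_one, sub_nonneg]
      exact (div_le_one (by linarith)).2 h1
  have hfin : μ univ ^ (1 / (1 : ℝ≥0∞).toReal - 1 / p.toReal) ≠ ∞ :=
    ENNReal.rpow_ne_top_of_nonneg hexp (measure_ne_top μ univ)
  have h := eLpNorm_le_eLpNorm_mul_rpow_measure_univ hp.out (Lp.aestronglyMeasurable u)
  rw [eLpNorm_one_eq_lintegral_enorm] at h
  rw [inclusionBound, ENNReal.ofReal_mul ENNReal.toReal_nonneg, ENNReal.ofReal_toReal hfin,
    Lp.norm_def, ENNReal.ofReal_toReal (Lp.eLpNorm_ne_top u), mul_comm]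
  exact h

theorem integrable_Lp [hp : Fact (1 ≤ p)] (u : Lp 𝕜 p μ) : Integrable u μ :=
  (Lp.memLp u).integrable hp.out

/-- The integral over a set as a continuous functional on `L^p` of a finite measure. -/
def setIntegralLp [hp : Fact (1 ≤ p)] (A : Set X) : Lp 𝕜 p μ →L[ℝ] 𝕜 :=
  LinearMap.mkContinuous
    { toFun := fun u => ∫ x in A, u x ∂μ
      map_add' := fun u v => by
        rw [← integral_add (integrable_Lp u).integrableOn (integrable_Lp v).integrableOn]
        exact integral_congr_ae (ae_restrict_of_ae (Lp.coeFn_add u v))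
      map_smul' := fun c u => by
        rw [RingHom.id_apply, ← integral_smul]
        exact integral_congr_ae (ae_restrict_of_ae (Lp.coeFn_smul c u)) }
    (inclusionBound μ p) fun u => by
      have h := (enorm_integral_le_lintegral_enorm (μ := μ.restrict A) fun x => u x).trans
        ((setLIntegral_le_lintegral _ _).trans (lintegral_enorm_Lp_le u))
      rw [← ofReal_norm] at h
      exact (ENNReal.ofReal_le_ofReal_iff
        (mul_nonneg ENNReal.toReal_nonneg (norm_nonneg _))).1 h

theorem setIntegralLp_apply [hp : Fact (1 ≤ p)] (A : Set X) (u : Lp 𝕜 p μ) :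
    setIntegralLp A u = ∫ x in A, u x ∂μ := rfl

/-- The integral of a continuous curve in `L^p` is represented by the pointwise integrals. -/
theorem coeFn_intervalIntegral_Lp [hp : Fact (1 ≤ p)] {m : ℝ → Lp 𝕜 p μ} (hm : Continuous m)
    {M : X → ℝ → 𝕜} (hM : Measurable (Function.uncurry M)) (hmM : ∀ t, m t =ᵐ[μ] fun x => M x t)
    {a b : ℝ} (hab : a ≤ b) :
    (∫ t in a..b, m t : Lp 𝕜 p μ) =ᵐ[μ] fun x => ∫ t in a..b, M x t := by
  have hint : Integrable (Function.uncurry M) (μ.prod (volume.restrict (Ioc a b))) := by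
    refine ⟨hM.aestronglyMeasurable, ?_⟩
    rw [HasFiniteIntegral, lintegral_prod_symm _ hM.enorm.aemeasurable]
    obtain ⟨C, hC⟩ := (isCompact_Icc (a := a) (b := b)).exists_bound_of_continuousOn hm.continuousOn
    refine lt_of_le_of_lt (setLIntegral_mono' (g := fun _ =>
      ENNReal.ofReal (inclusionBound μ p * C)) measurableSet_Ioc fun t ht => ?_) (by
        rw [setLIntegral_const]
        exact ENNReal.mul_lt_top ENNReal.ofReal_lt_top measure_Ioc_lt_top)
    have h1 : ∫⁻ x, ‖Function.uncurry M (x, t)‖ₑ ∂μ = ∫⁻ x, ‖m t x‖ₑ ∂μ :=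
      lintegral_congr_ae ((hmM t).mono fun x hx => by simp [hx])
    rw [h1]
    refine (lintegral_enorm_Lp_le _).trans (ENNReal.ofReal_le_ofReal ?_)
    exact mul_le_mul_of_nonneg_left (hC t (Ioc_subset_Icc_self ht)) ENNReal.toReal_nonneg
  have hleft : (fun x => ∫ t in a..b, M x t) = fun x => ∫ t in Ioc a b, M x t :=
    funext fun x => intervalIntegral.integral_of_le hab
  rw [hleft]
  refine Integrable.ae_eq_of_forall_setIntegral_eq _ _ (integrable_Lp _) hint.integral_prod_left
    fun A hA _ => ?_
  have h2 : Integrable (Function.uncurry M) ((μ.restrict A).prod (volume.restrict (Ioc a b))) :=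
    hint.mono_measure (Measure.prod_mono Measure.restrict_le_self le_rfl)
  rw [← setIntegralLp_apply, ← ContinuousLinearMap.intervalIntegral_comp_comm _
    (hm.intervalIntegrable a b), intervalIntegral.integral_of_le hab,
    integral_integral_swap (f := M) h2]
  refine integral_congr_ae (Eventually.of_forall fun t => ?_)
  exact integral_congr_ae (ae_restrict_of_ae (hmM t))

end

/-! ### Spherical means on `L^p` -/

section
variable {𝕜 : Type*} [RCLike 𝕜] {n k : ℕ} {p : ℝ≥0∞}

theorem measurable_parallelMean_center (hk : k < n) {τ : S n → SO n}
    (hτ : ∀ x, rotS (τ x) (poleS n) = x) {f : S n → 𝕜} (hf : Measurable f) :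
    Measurable fun q : S n × ℝ => parallelMean hk f (τ q.1) q.2 :=
  measurable_integral_haarK hτ hf (continuous_meridian hk).measurable

theorem measurable_parallelNorm_center (hk : k < n) {τ : S n → SO n}
    (hτ : ∀ x, rotS (τ x) (poleS n) = x) {f : S n → 𝕜} (hf : Measurable f) :
    Measurable fun q : S n × ℝ => parallelNorm hk f (τ q.1) q.2 :=
  measurable_lintegral_haarK hτ hf.enorm (continuous_meridian hk).measurable

/-- Spherical means do not increase the `L^p` norm. -/
theorem eLpNorm_parallelMean_le (hk : k < n) {τ : S n → SO n}
    (hτ : ∀ x, rotS (τ x) (poleS n) = x) {f : S n → 𝕜} (hf : Measurable f) (hp1 : 1 ≤ p)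
    (hp : p ≠ ∞) (t : ℝ) :
    eLpNorm (fun x => parallelMean hk f (τ x) t) p (sigma n) ≤ eLpNorm f p (sigma n) := by
  have hp0 : p ≠ 0 := (zero_lt_one.trans_le hp1).ne'
  have hpr : 0 < p.toReal := ENNReal.toReal_pos hp0 hp
  have hmeas : ∀ g : SO n, Measurable fun ρ : K n => f (rotS g (rotS ρ.1 (meridian hk t))) := by
    intro g
    have h := measurable_rotS_rotS (X := K n) (measurable_const (a := g)) measurable_id
      (measurable_const (a := meridian hk t))
    have h' := hf.comp h
    exact h'
  have hJ : ∀ g : SO n, ‖parallelMean hk f g t‖ₑ ^ p.toReal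
      ≤ ∫⁻ ρ : K n, ‖f (rotS g (rotS ρ.1 (meridian hk t)))‖ₑ ^ p.toReal ∂haarK n := by
    intro g
    have h1 := eLpNorm_le_eLpNorm_of_exponent_le (μ := haarK n) hp1 (hmeas g).aestronglyMeasurable
    rw [eLpNorm_one_eq_lintegral_enorm, eLpNorm_eq_lintegral_rpow_enorm_toReal hp0 hp] at h1
    have h2 := (enorm_parallelMean_le hk f g t).trans h1
    calc _ ≤ _ := ENNReal.rpow_le_rpow h2 hpr.le
      _ = _ := by rw [← ENNReal.rpow_mul, one_div_mul_cancel hpr.ne', ENNReal.rpow_one]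
  rw [eLpNorm_eq_lintegral_rpow_enorm_toReal hp0 hp, eLpNorm_eq_lintegral_rpow_enorm_toReal hp0 hp]
  refine ENNReal.rpow_le_rpow ?_ (by positivity)
  refine (lintegral_mono fun x => hJ (τ x)).trans (le_of_eq ?_)
  exact lintegral_sigma_lintegral_haarK hτ (F := fun y => ‖f y‖ₑ ^ p.toReal)
    (hf.enorm.pow_const _) (meridian hk t)

theorem memLp_parallelMean (hk : k < n) {τ : S n → SO n}
    (hτ : ∀ x, rotS (τ x) (poleS n) = x) {f : S n → 𝕜} (hf : Measurable f) (hp1 : 1 ≤ p)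
    (hp : p ≠ ∞) (hfp : MemLp f p (sigma n)) (t : ℝ) :
    MemLp (fun x => parallelMean hk f (τ x) t) p (sigma n) := by
  have hm : Measurable fun x => parallelMean hk f (τ x) t := by
    have h := (measurable_parallelMean_center hk hτ hf).comp (measurable_prodMk_right (y := t))
    exact h
  exact ⟨hm.aestronglyMeasurable, (eLpNorm_parallelMean_le hk hτ hf hp1 hp t).trans_lt hfp.2⟩

theorem ae_integrable_comp_rotS_rotS {τ : S n → SO n} (hτ : ∀ x, rotS (τ x) (poleS n) = x)
    {f : S n → 𝕜} (hf : Measurable f) (hfi : Integrable f (sigma n)) (y : S n) :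
    ∀ᵐ x ∂sigma n, Integrable (fun ρ : K n => f (rotS (τ x) (rotS ρ.1 y))) (haarK n) := by
  have hm : Measurable fun x => ∫⁻ ρ : K n, ‖f (rotS (τ x) (rotS ρ.1 y))‖ₑ ∂haarK n := by
    have h := (measurable_lintegral_haarK hτ hf.enorm (y := fun _ => y) measurable_const).comp
      (measurable_prodMk_right (y := (0 : ℝ)))
    exact h
  have h := lintegral_sigma_lintegral_haarK hτ hf.enorm y
  filter_upwards [ae_lt_top hm (by rw [h]; exact hfi.2.ne)] with x hx
  have hmx : Measurable fun ρ : K n => f (rotS (τ x) (rotS ρ.1 y)) := by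
    have h := measurable_rotS_rotS (X := K n) (measurable_const (a := τ x)) measurable_id
      (measurable_const (a := y))
    have h' := hf.comp h
    exact h'
  exact ⟨hmx.aestronglyMeasurable, hx⟩

theorem parallelMean_sub_ae (hk : k < n) {τ : S n → SO n} (hτ : ∀ x, rotS (τ x) (poleS n) = x)
    {f g : S n → 𝕜} (hf : Measurable f) (hg : Measurable g) (hfi : Integrable f (sigma n))
    (hgi : Integrable g (sigma n)) (t : ℝ) :
    ((fun x => parallelMean hk f (τ x) t) - fun x => parallelMean hk g (τ x) t)
      =ᵐ[sigma n] fun x => parallelMean hk (f - g) (τ x) t := by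
  filter_upwards [ae_integrable_comp_rotS_rotS hτ hf hfi (meridian hk t),
    ae_integrable_comp_rotS_rotS hτ hg hgi (meridian hk t)] with x h1 h2
  simp only [Pi.sub_apply, parallelMean]
  rw [integral_sub h1 h2]

/-- The spherical mean at the height `t`, as an element of `L^p`. -/
def meanLp (hk : k < n) {τ : S n → SO n} (hτ : ∀ x, rotS (τ x) (poleS n) = x) {f : S n → 𝕜}
    (hf : Measurable f) (hp1 : 1 ≤ p) (hp : p ≠ ∞) (hfp : MemLp f p (sigma n)) (t : ℝ) :
    Lp 𝕜 p (sigma n) :=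
  (memLp_parallelMean hk hτ hf hp1 hp hfp t).toLp _

theorem meanLp_one (hk : k < n) {τ : S n → SO n} (hτ : ∀ x, rotS (τ x) (poleS n) = x) {f : S n → 𝕜}
    (hf : Measurable f) (hp1 : 1 ≤ p) (hp : p ≠ ∞) (hfp : MemLp f p (sigma n)) :
    meanLp hk hτ hf hp1 hp hfp 1 = hfp.toLp f := by
  refine (MemLp.toLp_eq_toLp_iff _ _).2 (Eventually.of_forall fun x => ?_)
  simp only
  rw [parallelMean_one, hτ]

theorem edist_meanLp_le (hk : k < n) {τ : S n → SO n} (hτ : ∀ x, rotS (τ x) (poleS n) = x)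
    {f g : S n → 𝕜} (hf : Measurable f) (hg : Measurable g) (hp1 : 1 ≤ p) (hp : p ≠ ∞)
    (hfp : MemLp f p (sigma n)) (hgp : MemLp g p (sigma n)) (t : ℝ) :
    edist (meanLp hk hτ hf hp1 hp hfp t) (meanLp hk hτ hg hp1 hp hgp t)
      ≤ eLpNorm (f - g) p (sigma n) := by
  rw [meanLp, meanLp, Lp.edist_toLp_toLp, eLpNorm_congr_ae
    (parallelMean_sub_ae hk hτ hf hg (hfp.integrable hp1) (hgp.integrable hp1) t)]
  exact eLpNorm_parallelMean_le hk hτ (hf.sub hg) hp1 hp t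

theorem continuous_meanLp_of_continuous [Fact (1 ≤ p)] (hk : k < n) {τ : S n → SO n}
    (hτ : ∀ x, rotS (τ x) (poleS n) = x) {f : S n → 𝕜} (hf : Continuous f) (hp1 : 1 ≤ p)
    (hp : p ≠ ∞) (hfp : MemLp f p (sigma n)) :
    Continuous (meanLp hk hτ hf.measurable hp1 hp hfp) := by
  refine continuous_iff_continuousAt.2 fun t => Metric.tendsto_nhds.2 fun ε hε => ?_
  set c : ℝ := measureUnivNNReal (sigma n) ^ p.toReal⁻¹ with hc
  have hc0 : 0 ≤ c := by positivity
  have hδ : 0 < ε / (c + 1) := by positivity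
  filter_upwards [eventually_norm_parallelMean_sub_le hk hf t hδ] with t' ht'
  rw [dist_eq_norm]
  refine (Lp.norm_le_of_ae_bound (C := ε / (c + 1)) hδ.le ?_).trans_lt ?_
  · filter_upwards [Lp.coeFn_sub (meanLp hk hτ hf.measurable hp1 hp hfp t')
      (meanLp hk hτ hf.measurable hp1 hp hfp t),
      (memLp_parallelMean hk hτ hf.measurable hp1 hp hfp t').coeFn_toLp,
      (memLp_parallelMean hk hτ hf.measurable hp1 hp hfp t).coeFn_toLp] with x h1 h2 h3
    rw [h1, Pi.sub_apply, meanLp, meanLp, h2, h3]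
    exact ht' (τ x)
  · rw [← hc, mul_div_assoc', div_lt_iff₀ (by positivity)]
    nlinarith

/-- Spherical means of an `L^p` function depend continuously on the height. -/
theorem continuous_meanLp [Fact (1 ≤ p)] (hk : k < n) {τ : S n → SO n}
    (hτ : ∀ x, rotS (τ x) (poleS n) = x) {f : S n → 𝕜} (hf : Measurable f) (hp1 : 1 ≤ p)
    (hp : p ≠ ∞) (hfp : MemLp f p (sigma n)) :
    Continuous (meanLp hk hτ hf hp1 hp hfp) := by
  -- Means of continuous functions approximate the means of `f`, uniformly in `t`.
  refine continuous_of_uniform_approx_of_continuous fun u hu => ?_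
  obtain ⟨ε, hε, hεu⟩ := mem_uniformity_edist.1 hu
  obtain ⟨δ, hδ, hδε⟩ := exists_between hε
  obtain ⟨g, hg, hgp⟩ := hfp.exists_boundedContinuous_eLpNorm_sub_le hp hδ.ne'
  refine ⟨_, continuous_meanLp_of_continuous hk hτ g.continuous hp1 hp hgp, fun t => hεu ?_⟩
  exact ((edist_meanLp_le hk hτ hf g.continuous.measurable hp1 hp hfp hgp t).trans hg).trans_lt hδε

theorem coeFn_powIntegral_meanLp [Fact (1 ≤ p)] (hk : k < n) {τ : S n → SO n}
    (hτ : ∀ x, rotS (τ x) (poleS n) = x) {f : S n → 𝕜} (hf : Measurable f) (hp1 : 1 ≤ p)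
    (hp : p ≠ ∞) (hfp : MemLp f p (sigma n)) {q : ℝ → ℝ} (hq : Continuous q) (j : ℕ) (c : ℝ) {s : ℝ}
    (hs : 0 ≤ s) :
    (c • powIntegral q j (meanLp hk hτ hf hp1 hp hfp) s : Lp 𝕜 p (sigma n))
      =ᵐ[sigma n] fun x => c • ∫ t in (0 : ℝ)..s, (q s - q t) ^ j • parallelMean hk f (τ x) t := by
  have hM : Measurable (Function.uncurry fun (x : S n) (t : ℝ) =>
      (q s - q t) ^ j • parallelMean hk f (τ x) t) := by
    have h1 : Measurable fun x : S n × ℝ => (q s - q x.2) ^ j := by fun_prop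
    exact h1.smul (measurable_parallelMean_center hk hτ hf)
  have hqc : Continuous fun t => (q s - q t) ^ j := by fun_prop
  have h := coeFn_intervalIntegral_Lp (m := fun t => (q s - q t) ^ j • meanLp hk hτ hf hp1 hp hfp t)
    (hqc.smul (continuous_meanLp hk hτ hf hp1 hp hfp)) hM (fun t => by
      filter_upwards [Lp.coeFn_smul ((q s - q t) ^ j) (meanLp hk hτ hf hp1 hp hfp t),
        (memLp_parallelMean hk hτ hf hp1 hp hfp t).coeFn_toLp] with x h1 h2
      rw [h1, Pi.smul_apply, meanLp, h2]) hs
  filter_upwards [h, Lp.coeFn_smul c (powIntegral q j (meanLp hk hτ hf hp1 hp hfp) s)] with x h1 h2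
  rw [h2, Pi.smul_apply, powIntegral, h1]

end

/-! ### Recovery in `L^p` -/

section
variable {𝕜 : Type*} [RCLike 𝕜] {n k : ℕ} {p : ℝ≥0∞}

theorem lpRecovers_eulerD [hp1 : Fact (1 ≤ p)] (hk : k < n) {τ : S n → SO n}
    (hτ : ∀ x, rotS (τ x) (poleS n) = x) (hp : p ≠ ∞) {f f' : S n → 𝕜} (hf : MemLp f p (sigma n))
    (hm : Measurable f') (hff : f' =ᵐ[sigma n] f) {j : ℕ} (hj : 1 ≤ j) {F : S n → ℝ → 𝕜}
    (hF : ∀ᵐ x ∂sigma n, ∀ s ∈ Ioo (0 : ℝ) 1, F x s = (2 / ((j - 1).factorial : ℝ)) •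
      ∫ t in (0 : ℝ)..s, (s ^ 2 - t ^ 2) ^ (j - 1) • parallelMean hk f' (τ x) t) :
    LpRecovers hf j (eulerD^[j]) F := by
  obtain ⟨i, rfl⟩ := Nat.exists_eq_add_of_le' hj
  simp only [Nat.add_sub_cancel] at hF
  have hfp : MemLp f' p (sigma n) := hf.ae_eq hff.symm
  have hc := continuous_meanLp hk hτ hm hp1.out hp hfp
  refine ⟨fun s => (2 / (i.factorial : ℝ)) •
    powIntegral (· ^ 2) i (meanLp hk hτ hm hp1.out hp hfp) s, fun s hs => ?_, ?_, ?_⟩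
  · filter_upwards [hF, coeFn_powIntegral_meanLp hk hτ hm hp1.out hp hfp (continuous_pow 2) i
      (2 / (i.factorial : ℝ)) hs.1.le] with x h1 h2
    rw [h2, h1 s hs]
  · exact ((contDiff_powIntegral hasDerivAt_sq (fun j => contDiff_const.mul contDiff_id) i
      hc).const_smul _).contDiffOn
  · have h1 : Tendsto (fun s : ℝ => s⁻¹ • meanLp hk hτ hm hp1.out hp hfp s) (𝓝[<] 1)
        (𝓝 (hf.toLp f)) := by
      have h := ((continuousAt_inv₀ (one_ne_zero (α := ℝ))).smul hc.continuousAt).tendsto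
      rw [Pi.smul_apply', meanLp_one, inv_one, one_smul, (MemLp.toLp_eq_toLp_iff hfp hf).2 hff] at h
      exact h.mono_left nhdsWithin_le_nhds
    refine h1.congr' ?_
    filter_upwards [Ioo_mem_nhdsLT zero_lt_one] with s hs
    exact (eulerD_iterate_powIntegral i hc hs.1).symm

theorem lpRecovers_iteratedDeriv [hp1 : Fact (1 ≤ p)] (hk : k < n) {τ : S n → SO n}
    (hτ : ∀ x, rotS (τ x) (poleS n) = x) (hp : p ≠ ∞) {f f' : S n → 𝕜} (hf : MemLp f p (sigma n))
    (hm : Measurable f') (hff : f' =ᵐ[sigma n] f) {j : ℕ} (hj : 1 ≤ j) {F : S n → ℝ → 𝕜}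
    (hF : ∀ᵐ x ∂sigma n, ∀ s ∈ Ioo (0 : ℝ) 1, F x s = (1 / ((j - 1).factorial : ℝ)) •
      ∫ t in (0 : ℝ)..s, (s - t) ^ (j - 1) • parallelMean hk f' (τ x) t) :
    LpRecovers hf j (iteratedDeriv j) F := by
  obtain ⟨i, rfl⟩ := Nat.exists_eq_add_of_le' hj
  simp only [Nat.add_sub_cancel] at hF
  have hfp : MemLp f' p (sigma n) := hf.ae_eq hff.symm
  have hc := continuous_meanLp hk hτ hm hp1.out hp hfp
  refine ⟨fun s => (1 / (i.factorial : ℝ)) •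
    powIntegral id i (meanLp hk hτ hm hp1.out hp hfp) s, fun s hs => ?_, ?_, ?_⟩
  · filter_upwards [hF, coeFn_powIntegral_meanLp hk hτ hm hp1.out hp hfp continuous_id i
      (1 / (i.factorial : ℝ)) hs.1.le] with x h1 h2
    rw [h2, h1 s hs]
    rfl
  · exact ((contDiff_powIntegral (fun s => hasDerivAt_id s) (fun j => contDiff_const) i
      hc).const_smul _).contDiffOn
  · rw [iteratedDeriv_powIntegral i hc]
    have h := (hc.continuousAt (x := 1)).tendsto
    rw [meanLp_one, (MemLp.toLp_eq_toLp_iff hfp hf).2 hff] at h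
    exact h.mono_left nhdsWithin_le_nhds

/-- A function that is even almost everywhere has an everywhere even Borel representative. -/
theorem exists_measurable_even {f : S n → 𝕜} (hf : AEStronglyMeasurable f (sigma n))
    (he : ∀ᵐ x ∂sigma n, f (-x) = f x) :
    ∃ f' : S n → 𝕜, Measurable f' ∧ (∀ x, f' (-x) = f' x) ∧ f' =ᵐ[sigma n] f := by
  have hm : Measurable (hf.mk f) := hf.stronglyMeasurable_mk.measurable
  have hneg := (measurePreserving_neg_sigma n).quasiMeasurePreserving.ae hf.ae_eq_mk
  refine ⟨fun x => (1 / 2 : ℝ) • (hf.mk f x + hf.mk f (-x)), ?_, fun x => ?_, ?_⟩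
  · exact (hm.add (hm.comp (measurePreserving_neg_sigma n).measurable)).const_smul (1 / 2 : ℝ)
  · simp only [neg_neg]
    rw [add_comm]
  · filter_upwards [he, hf.ae_eq_mk, hneg] with x h1 h2 h3
    rw [← h2, ← h3, h1, ← two_smul ℝ, smul_smul]
    norm_num

/-- Integration over all centers and over the parallels with heights in `A`. -/
theorem lintegral_lintegral_parallel (hk : k < n) {τ : S n → SO n}
    (hτ : ∀ x, rotS (τ x) (poleS n) = x) {F : S n → ℝ≥0∞} (hF : Measurable F) (A : Set ℝ) :
    ∫⁻ x, (∫⁻ t in A, ∫⁻ ρ : K n, F (rotS (τ x) (rotS ρ.1 (meridian hk t))) ∂haarK n) ∂sigma n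
      = (∫⁻ x, F x ∂sigma n) * volume A := by
  have hm := measurable_lintegral_haarK hτ hF (continuous_meridian hk).measurable
  rw [lintegral_lintegral_swap hm.aemeasurable]
  simp_rw [lintegral_sigma_lintegral_haarK hτ hF]
  rw [setLIntegral_const]

/-- Around almost every center, almost no parallel meets a given null set, and the representative
`f'` is integrable along parallels. -/
theorem ae_admissibleAt (hk : k < n) {τ : S n → SO n} (hτ : ∀ x, rotS (τ x) (poleS n) = x)
    {f f' : S n → 𝕜} (hm : Measurable f') (he : ∀ x, f' (-x) = f' x) (hi : Integrable f' (sigma n))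
    (hff : f' =ᵐ[sigma n] f) : ∀ᵐ x ∂sigma n, AdmissibleAt hk f f' (τ x) := by
  -- The set where the functions differ need not be measurable.
  set N : Set (S n) := toMeasurable (sigma n) {x | ¬ f' x = f x} with hN
  have hNm : MeasurableSet N := measurableSet_toMeasurable _ _
  have hN0 : sigma n N = 0 := by rw [hN, measure_toMeasurable]; exact hff
  have hNf : ∀ x, x ∉ N → f x = f' x := fun x hx => by
    by_contra h
    exact hx (subset_toMeasurable _ _ fun h' => h h'.symm)
  have hind : Measurable (N.indicator (1 : S n → ℝ≥0∞)) := measurable_one.indicator hNm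
  have h1m := measurable_lintegral_haarK hτ hind (continuous_meridian hk).measurable
  have h2m := measurable_parallelNorm_center hk hτ hm
  have h1 := lintegral_lintegral_parallel hk hτ hind (Ioo (-1) 1)
  rw [lintegral_indicator_one hNm, hN0, zero_mul,
    lintegral_eq_zero_iff (Measurable.lintegral_prod_right' h1m)] at h1
  have h2 : ∫⁻ x, (∫⁻ t in Ioo (0 : ℝ) 1, parallelNorm hk f' (τ x) t) ∂sigma n ≠ ∞ := by
    refine (lintegral_lintegral_parallel hk hτ hm.enorm (Ioo 0 1)).trans_ne ?_
    exact ENNReal.mul_ne_top hi.2.ne measure_Ioo_lt_top.ne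
  filter_upwards [h1, ae_lt_top (Measurable.lintegral_prod_right' h2m) h2] with x hx1 hx2
  refine ⟨hm, he, ⟨N, hNm, hNf, ?_⟩, hx2⟩
  have h1x : Measurable fun t => ∫⁻ ρ : K n,
      N.indicator (1 : S n → ℝ≥0∞) (rotS (τ x) (rotS ρ.1 (meridian hk t))) ∂haarK n := by
    have h := h1m.comp (measurable_prodMk_left (x := x))
    exact h
  exact (lintegral_eq_zero_iff h1x).1 hx1

end

end FunkRadon

end

open FunkRadon in
theorem theorem5 {𝕜 : Type*} [RCLike 𝕜] (n k : ℕ) (hk : 1 ≤ k) (hkn : k < n)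
    (τ : S n → SO n) (hτ : ∀ x : S n, rot (τ x) (pole n) = x) :
    (∀ (p : ℝ≥0∞) [Fact (1 ≤ p)], p ≠ ∞ →
      ∀ (f : S n → 𝕜) (hf : MemLp f p (sigma n)), (∀ᵐ x ∂sigma n, f (-x) = f x) →
        (∀ᵐ x ∂sigma n, DualRadonConverges (k := k) hkn f (τ x) ∧
          ∀ s ∈ Ioo (0 : ℝ) 1,
            EKConverges k k (shiftedDual (k := k) hkn (radon f) (τ x)) s ∧
            EKConverges k 1 (shiftedDual (k := k) hkn (radon f) (τ x)) s) ∧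
        LpRecovers hf k (eulerD^[k]) (fun x s =>
          (Real.pi ^ (-(k : ℝ) / 2) / Real.Gamma ((k : ℝ) / 2)) •
            ekIntegral k k (shiftedDual (k := k) hkn (radon f) (τ x)) s) ∧
        (Even k → LpRecovers hf (k / 2) (eulerD^[k / 2]) (fun x s =>
          (1 / (2 * Real.pi ^ ((k : ℝ) / 2))) •
            (s ^ (k - 1) • shiftedDual (k := k) hkn (radon f) (τ x) s))) ∧
        LpRecovers hf k (iteratedDeriv k) (fun x s =>
          ((2 : ℝ) ^ (-(k : ℝ)) * Real.pi ^ (-(k : ℝ) / 2) / Real.Gamma ((k : ℝ) / 2)) •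
            ekIntegral k 1 (shiftedDual (k := k) hkn (radon f) (τ x)) s)) ∧
    (∀ f : S n → 𝕜, Continuous f → (∀ x, f (-x) = f x) →
        UniformlyRecovers f k (eulerD^[k]) (fun x s =>
          (Real.pi ^ (-(k : ℝ) / 2) / Real.Gamma ((k : ℝ) / 2)) •
            ekIntegral k k (shiftedDual (k := k) hkn (radon f) (τ x)) s) ∧
        (Even k → UniformlyRecovers f (k / 2) (eulerD^[k / 2]) (fun x s =>
          (1 / (2 * Real.pi ^ ((k : ℝ) / 2))) •
            (s ^ (k - 1) • shiftedDual (k := k) hkn (radon f) (τ x) s))) ∧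
        UniformlyRecovers f k (iteratedDeriv k) (fun x s =>
          ((2 : ℝ) ^ (-(k : ℝ)) * Real.pi ^ (-(k : ℝ) / 2) / Real.Gamma ((k : ℝ) / 2)) •
            ekIntegral k 1 (shiftedDual (k := k) hkn (radon f) (τ x)) s)) := by

  have hτ' : ∀ x, rotS (τ x) (poleS n) = x := fun x => rotS_poleS (hτ x)
  have hk2 : Even k → 1 ≤ k / 2 := by
    rintro ⟨j, hj⟩
    omega
  refine ⟨?_, ?_⟩
  · intro p hp1 hp f hf he
    obtain ⟨f', hm, he', hff⟩ := exists_measurable_even hf.1 he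
    have hA := ae_admissibleAt hkn hτ' hm he' ((hf.ae_eq hff.symm).integrable hp1.out) hff
    refine ⟨?_, ?_, fun hev => ?_, ?_⟩
    · filter_upwards [hA] with x h
      exact ⟨h.dualRadonConverges hk, fun s hs =>
        ⟨(h.ek_formula_sq hk hs).1, (h.ek_formula_linear hk hs).1⟩⟩
    · exact lpRecovers_eulerD hkn hτ' hp hf hm hff hk
        (hA.mono fun x h s hs => (h.ek_formula_sq hk hs).2)
    · exact lpRecovers_eulerD hkn hτ' hp hf hm hff (hk2 hev)
        (hA.mono fun x h s hs => h.even_formula hk hev hs)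
    · exact lpRecovers_iteratedDeriv hkn hτ' hp hf hm hff hk
        (hA.mono fun x h s hs => (h.ek_formula_linear hk hs).2)
  · intro f hf he
    have hA := fun x => admissibleAt_of_continuous hkn hf he (τ x)
    refine ⟨?_, fun hev => ?_, ?_⟩
    · exact uniformlyRecovers_eulerD hkn hτ' hf hk
        fun x s hs => ((hA x).ek_formula_sq hk hs).2
    · exact uniformlyRecovers_eulerD hkn hτ' hf (hk2 hev)
        fun x s hs => (hA x).even_formula hk hev hs
    · exact uniformlyRecovers_iteratedDeriv hkn hτ' hf hk
        fun x s hs => ((hA x).ek_formula_linear hk hs).2
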